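/- **Setting.** Fix integers $N\ge 1$ and $p\ge 0$, real coefficients $J_{j_1,\dots,j_q}$ for $0\le q\le p$ and $j_1,\dots,j_q\in\{1,\dots,N\}\times\{1,2,3\}$, and $\beta>0$. For $s\in\{\tfrac12,1,\tfrac32,\dots\}$ let $s_1,s_2,s_3$ be the usual spin-$s$ matrices on $\mathbb C^{2s+1}$ with orthonormal basis $|m\rangle$, $m=s,s-1,\dots,-s$: $s_3|m\rangle=m|m\rangle$ and $s_\pm=s_1\pm i s_2$, $s_\pm|m\rangle=\sqrt{s(s+1)-m(m\pm1)}\,|m\pm1\rangle$. On $\mathcal H^{(N,s)}=(\mathbb C^{2s+1})^{\otimes N}$ let $s_{\mu,i}=1\otimes\cdots\otimes s_i\otimes\cdots\otimes 1$ ($s_i$ in the $\mu$-th factor), $\widehat s_{\mu,i}=s_{\mu,i}/s$, and $$\widehat H^{(s)}=\sum_{q=0}^{p}\ \sum_{j_1,\dots,j_q}J_{j_1,\dots,j_q}\,\widehat s_{j_1}\cdots\widehat s_{j_q},\qquad G^{(N,s)}=\frac{e^{-\beta\widehat H^{(s)}}}{\operatorname{Tr}e^{-\beta\widehat H^{(s)}}}.$$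 Let $\mathcal S=(S^2)^N$, where $S^2$ is the unit sphere of $\mathbb R^3$ with surface measure $d\Omega$ of total mass $4\pi$. For $\boldsymbol\Omega=(\Omega_1,\dots,\Omega_N)\in\mathcal S$, with $\Omega_{\mu,i}$ the $i$-th component of $\Omega_\mu$, let $$H^{cl}(\boldsymbol\Omega)=\sum_{q=0}^{p}\ \sum_{j_1,\dots,j_q}J_{j_1,\dots,j_q}\,\Omega_{j_1}\cdots\Omega_{j_q},\qquad Z^{cl}(\beta)=(4\pi)^{-N}\int_{\mathcal S}e^{-\beta H^{cl}(\boldsymbol\Omega)}\,d\Omega_1\cdots d\Omega_N.$$ For $\Omega=(\sin\theta\cos\varphi,\sin\theta\sin\varphi,\cos\theta)\in S^2$ with $0\le\theta\le\pi$ put $U(\Omega)=\exp\!\big[\tfrac\theta2\big(e^{i\varphi}s_--e^{-i\varphi}s_+\big)\big]$ (with $\varphi=0$ at the poles $\theta=0,\pi$), let $|\boldsymbol\Omega\rangle=U(\Omega_1)|s\rangle\otimes\cdots\otimes U(\Omega_N)|s\rangle$ be the spin coherent states, and for a linear operator $A$ on $\mathcal H^{(N,s)}$ let $g(A)(\boldsymbol\Omega)=\langle\boldsymbol\Omega|A|\boldsymbol\Omega\rangle$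 be its covariant symbol. **Theorem.** The functions $g(G^{(N,s)})$ are continuous on $\mathcal S$, and as $s\to\infty$ through $\{\tfrac12,1,\tfrac32,\dots\}$ $$(2s+1)^N\,g\big(G^{(N,s)}\big)\longrightarrow\frac{e^{-\beta H^{cl}}}{Z^{cl}(\beta)}$$ in the sup-norm on $C(\mathcal S)$. Moreover $$\lim_{s\to\infty}(2s+1)^{-N}\operatorname{Tr}e^{-\beta\widehat H^{(s)}}=Z^{cl}(\beta).$$ (If $\widehat H^{(s)}$ is not Hermitian, $C(\mathcal S)$ denotes the complex-valued continuous functions; the trace is then nonzero for all sufficiently large $s$, and for the other $s$, if any, put $G^{(N,s)}=0$.) -/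

import Mathlib

open MeasureTheory Filter Topology

noncomputable section

namespace SpinGibbs

/-! Single spin.  The spin quantum number is `s = n / 2` with `n : ℕ`; the basis vector `|m⟩` of
`ℂ^(2s+1)` with `m = s - k` has index `k : Fin (n + 1)`, so that index `0` is `|s⟩`. -/

/-- The spin quantum number `s = n / 2`. -/
def spin (n : ℕ) : ℝ := n / 2

/-- The magnetic quantum number `m = s - k` of the `k`-th basis vector. -/
def magnetic (n : ℕ) (k : Fin (n + 1)) : ℝ := spin n - (k : ℕ)

/-- The raising operator: `s₊ |m⟩ = √(s (s + 1) - m (m + 1)) |m + 1⟩`. -/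
def spinPlus (n : ℕ) : Matrix (Fin (n + 1)) (Fin (n + 1)) ℂ :=
  Matrix.of fun k l =>
    if (k : ℕ) + 1 = (l : ℕ) then
      ((√(spin n * (spin n + 1) - magnetic n l * (magnetic n l + 1)) : ℝ) : ℂ)
    else 0

/-- The lowering operator: `s₋ |m⟩ = √(s (s + 1) - m (m - 1)) |m - 1⟩`. -/
def spinMinus (n : ℕ) : Matrix (Fin (n + 1)) (Fin (n + 1)) ℂ :=
  Matrix.of fun k l =>
    if (k : ℕ) = (l : ℕ) + 1 then
      ((√(spin n * (spin n + 1) - magnetic n l * (magnetic n l - 1)) : ℝ) : ℂ)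
    else 0

/-- The spin operators `s₁, s₂, s₃` (indexed by `0, 1, 2`), where `s₊ = s₁ + i s₂`,
`s₋ = s₁ - i s₂` and `s₃ |m⟩ = m |m⟩`. -/
def spinOp (n : ℕ) : Fin 3 → Matrix (Fin (n + 1)) (Fin (n + 1)) ℂ :=
  ![(1 / 2 : ℂ) • (spinPlus n + spinMinus n),
    (1 / (2 * Complex.I)) • (spinPlus n - spinMinus n),
    Matrix.diagonal fun k => ((magnetic n k : ℝ) : ℂ)]

/-- The unit sphere in Euclidean `ℝ³`. -/
abbrev Sphere2 : Type := Metric.sphere (0 : EuclideanSpace ℝ (Fin 3)) 1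

/-- The polar angle `θ ∈ [0, π]` of a unit vector. -/
def polar (Ω : Sphere2) : ℝ := Real.arccos (Ω.1 2)

/-- The azimuth `φ` of a unit vector (modulo `2π`; it is set to `0` at the two poles, where it is
not determined and where `⟨Ω|A|Ω⟩` does not depend on its choice). -/
def azimuth (Ω : Sphere2) : ℝ := Complex.arg ⟨Ω.1 0, Ω.1 1⟩

/-- `U(Ω) = exp ((θ / 2) (e^{iφ} s₋ - e^{-iφ} s₊))`. -/
def rotation (n : ℕ) (Ω : Sphere2) : Matrix (Fin (n + 1)) (Fin (n + 1)) ℂ :=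
  NormedSpace.exp (((polar Ω / 2 : ℝ) : ℂ) •
    (Complex.exp (Complex.I * (azimuth Ω : ℂ)) • spinMinus n
      - Complex.exp (-(Complex.I * (azimuth Ω : ℂ))) • spinPlus n))

/-! `N` spins.  The `N`-fold tensor power of `ℂ^(2s+1)` is described in its orthonormal product
basis `|m₁, …, m_N⟩`, indexed by `Fin N → Fin (n + 1)`. -/

/-- Linear operators on the `N`-fold tensor power of `ℂ^(2s+1)`, as matrices in the product
basis. -/
abbrev Operator (N n : ℕ) : Type := Matrix (Fin N → Fin (n + 1)) (Fin N → Fin (n + 1)) ℂ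

/-- The tensor product `A₁ ⊗ ⋯ ⊗ A_N`. -/
def tensorOp {N n : ℕ} (A : Fin N → Matrix (Fin (n + 1)) (Fin (n + 1)) ℂ) : Operator N n :=
  Matrix.of fun k l => ∏ ν, A ν (k ν) (l ν)

/-- The operator `s_{μ,i} = 1 ⊗ ⋯ ⊗ s_i ⊗ ⋯ ⊗ 1`, with `s_i` as the `μ`-th factor;
here `j = (μ, i)`. -/
def siteSpinOp {N : ℕ} (n : ℕ) (j : Fin N × Fin 3) : Operator N n :=
  tensorOp (Function.update (fun _ => 1) j.1 (spinOp n j.2))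

/-- The scaled operator `s_{μ,i} / s`. -/
def scaledSpinOp {N : ℕ} (n : ℕ) (j : Fin N × Fin 3) : Operator N n :=
  ((spin n : ℂ))⁻¹ • siteSpinOp n j

/-- The classical phase space, the `N`-fold product of unit spheres. -/
abbrev PhaseSpace (N : ℕ) : Type := Fin N → Sphere2

/-- The spin coherent state `|Ω⟩ = (U(Ω₁) ⊗ ⋯ ⊗ U(Ω_N)) |s, …, s⟩`. -/
def coherentState {N : ℕ} (n : ℕ) (Ω : PhaseSpace N) : (Fin N → Fin (n + 1)) → ℂ :=
  Matrix.mulVec (tensorOp fun μ => rotation n (Ω μ)) (Pi.single (fun _ => 0) 1)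

/-- The covariant symbol `g(A)(Ω) = ⟨Ω|A|Ω⟩`. -/
def covariantSymbol {N n : ℕ} (A : Operator N n) (Ω : PhaseSpace N) : ℂ :=
  dotProduct (star (coherentState n Ω)) (Matrix.mulVec A (coherentState n Ω))

/-- Coefficients `J_{j₁,…,j_q}` of polynomials in (noncommuting) variables indexed by the pairs
`j = (μ, i)`, for every degree `q`. -/
abbrev Couplings (N : ℕ) : Type := (q : ℕ) → (Fin q → Fin N × Fin 3) → ℝ

/-- `Ĥ^(s) = ∑_{q ≤ p} ∑_{j₁,…,j_q} J_{j₁,…,j_q} ŝ_{j₁} ⋯ ŝ_{j_q}` (factors in this order). -/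
def hamiltonian {N : ℕ} (p : ℕ) (J : Couplings N) (n : ℕ) : Operator N n :=
  ∑ q ∈ Finset.range (p + 1), ∑ j : Fin q → Fin N × Fin 3,
    (J q j : ℂ) • (List.ofFn fun a => scaledSpinOp n (j a)).prod

/-- `H^cl = ∑_{q ≤ p} ∑_{j₁,…,j_q} J_{j₁,…,j_q} Ω_{j₁} ⋯ Ω_{j_q}`. -/
def classicalHamiltonian {N : ℕ} (p : ℕ) (J : Couplings N) (Ω : PhaseSpace N) : ℝ :=
  ∑ q ∈ Finset.range (p + 1), ∑ j : Fin q → Fin N × Fin 3,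
    J q j * ∏ a, (Ω (j a).1).1 (j a).2

/-- The unnormalized Gibbs state `exp (-β Ĥ^(s))`. -/
def boltzmann {N : ℕ} (p : ℕ) (J : Couplings N) (β : ℝ) (n : ℕ) : Operator N n :=
  NormedSpace.exp (((-β : ℝ) : ℂ) • hamiltonian p J n)

/-- The Gibbs state `exp (-β Ĥ^(s)) / Tr exp (-β Ĥ^(s))`. -/
def gibbsState {N : ℕ} (p : ℕ) (J : Couplings N) (β : ℝ) (n : ℕ) : Operator N n :=
  (Matrix.trace (boltzmann p J β n))⁻¹ • boltzmann p J β n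

/-- The surface measure `dΩ` of the unit sphere, of total mass `4π`. -/
def sphereMeasure : Measure Sphere2 := (volume : Measure (EuclideanSpace ℝ (Fin 3))).toSphere

/-- `Z^cl(β) = (4π)^{-N} ∫ exp (-β H^cl) dΩ₁ ⋯ dΩ_N`. -/
def classicalPartition {N : ℕ} (p : ℕ) (J : Couplings N) (β : ℝ) : ℝ :=
  ((4 * Real.pi) ^ N)⁻¹ *
    ∫ Ω : PhaseSpace N, Real.exp (-β * classicalHamiltonian p J Ω)
      ∂(Measure.pi fun _ : Fin N => sphereMeasure)

theorem continuous_classicalHamiltonian {N : ℕ} (p : ℕ) (J : Couplings N) :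
    Continuous (classicalHamiltonian p J) := by
  unfold classicalHamiltonian
  fun_prop

/-- The classical Gibbs state `exp (-β H^cl) / Z^cl(β)`, as a continuous function on the phase
space. -/
def classicalGibbs {N : ℕ} (p : ℕ) (J : Couplings N) (β : ℝ) : C(PhaseSpace N, ℂ) where
  toFun Ω :=
    (((classicalPartition p J β)⁻¹ * Real.exp (-β * classicalHamiltonian p J Ω) : ℝ) : ℂ)
  continuous_toFun := by
    have h := continuous_classicalHamiltonian p J
    fun_prop

end SpinGibbs

end

/-! The coherent state at `Ω` is an approximate joint eigenvector of the scaled spins. It is an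
exact eigenvector of `Ω · S` with eigenvalue `s`, and `∑ S_i² = s (s + 1)`, so expanding the square
gives `∑ ‖(S_i - s Ω_i) v‖² = s (s + 1) - 2 s² + s² = s` (`sum_norm_sq_apply_sub`). After division
by `s` each component has error at most `s^(-1/2) = √(2 / n)`, uniformly in `Ω`.

The scaled spins have norm at most 2, so the error survives products
(`norm_listProd_ofFn_apply_sub_le`) and the exponential (`norm_exp_apply_sub_exp_smul_le`) with
constants independent of `n` and `Ω`. Hence the symbol of `exp (-β Ĥ)` converges uniformly to `exp
(-β H^cl)`, at rate `n^(-1/2)`. Hermiticity of `Ĥ` plays no role.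

The resolution of the identity expresses the trace exactly as an integral of the symbol
(`integral_covariantSymbol`), so the trace limit follows from the uniform limit. Since `Z^cl > 0`,
dividing the two limits gives the Gibbs state.

The identity itself needs explicit coherent states: they are symmetric powers of the spinor `(cos
(θ/2), e^{iφ} sin (θ/2))` (`rotation_mulVec_single`). Their matrix elements then integrate to zero
off the diagonal, by rotation about the third axis, and to beta integrals on it. -/

noncomputable section

namespace SpinGibbs

/-! ### Integration over the unit sphere -/

-- Polar coordinates for a product of an angular and a radial factor. With a Gaussian radial factor
-- this transfers facts about Lebesgue measure, namely Fubini and isometry invariance, to the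
-- surface measure.
open Set in
theorem integral_eq_integral_sphere_mul_radial {𝕜 : Type*} [RCLike 𝕜]
    {F : EuclideanSpace ℝ (Fin 3) → 𝕜} {f : Sphere2 → 𝕜} {w : ℝ → 𝕜}
    (h : ∀ (ω : Sphere2) (r : ℝ), 0 < r → F (r • ω.1) = f ω * w r) :
    ∫ x, F x = (∫ ω, f ω ∂sphereMeasure) * ∫ r in Ioi (0 : ℝ), (r : 𝕜) ^ 2 * w r := by
  have hd : Module.finrank ℝ (EuclideanSpace ℝ (Fin 3)) = 3 := by simp
  let μ : Measure (EuclideanSpace ℝ (Fin 3)) := volume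
  calc
    ∫ x, F x = ∫ x : ({(0)}ᶜ : Set (EuclideanSpace ℝ (Fin 3))), F x.1 ∂(μ.comap (↑)) := by
      rw [integral_subtype_comap (measurableSet_singleton _).compl F, restrict_compl_singleton]
    _ = ∫ y, f y.1 * w y.2 ∂μ.toSphere.prod (.volumeIoiPow 2) := by
      have key := μ.measurePreserving_homeomorphUnitSphereProd.integral_comp
        (Homeomorph.measurableEmbedding _) (fun y => f y.1 * w y.2.1)
      rw [hd] at key
      rw [← key]
      refine integral_congr_ae (.of_forall fun x => ?_)
      simp only
      rw [← h _ _ (homeomorphUnitSphereProd _ x).2.2]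
      congr 1
      simp only [homeomorphUnitSphereProd_apply_snd_coe, homeomorphUnitSphereProd_apply_fst_coe]
      rw [smul_inv_smul₀ (norm_ne_zero_iff.2 x.2)]
    _ = (∫ ω, f ω ∂sphereMeasure) * ∫ r : Ioi (0 : ℝ), w r ∂.volumeIoiPow 2 :=
      integral_prod_mul f fun r : Ioi (0 : ℝ) => w r
    _ = _ := by
      congr 1
      simp only [Measure.volumeIoiPow, ENNReal.ofReal]
      rw [integral_withDensity_eq_integral_smul,
        integral_subtype_comap measurableSet_Ioi fun a ↦ Real.toNNReal (a ^ 2) • w a,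
        setIntegral_congr_fun measurableSet_Ioi fun x hx ↦ ?_]
      · simp only [NNReal.smul_def]
        rw [Real.coe_toNNReal _ (sq_nonneg _), RCLike.real_smul_eq_coe_mul]
        push_cast
        rfl
      · exact (measurable_subtype_coe.pow_const _).real_toNNReal

open Set in
theorem integral_pow_mul_exp_neg_sq (j : ℕ) :
    ∫ r in Ioi (0 : ℝ), r ^ j * Real.exp (-r ^ 2) = Real.Gamma ((j + 1) / 2) / 2 := by
  have h := integral_rpow_mul_exp_neg_rpow (p := 2) (q := j) (by norm_num)
    (by have : (0 : ℝ) ≤ j := Nat.cast_nonneg j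
        linarith)
  simp only [Real.rpow_natCast, Real.rpow_ofNat] at h
  rw [h]
  ring

open Set in
theorem integral_pow_mul_exp_neg_sq_of_even {j : ℕ} (hj : Even j) :
    ∫ t : ℝ, t ^ j * Real.exp (-t ^ 2) = Real.Gamma ((j + 1) / 2) := by
  have h := integral_comp_abs (f := fun t : ℝ => t ^ j * Real.exp (-t ^ 2))
  simp only [hj.pow_abs, sq_abs] at h
  rw [h, integral_pow_mul_exp_neg_sq]
  ring

theorem integral_pow_mul_exp_neg_sq_of_odd {j : ℕ} (hj : Odd j) :
    ∫ t : ℝ, t ^ j * Real.exp (-t ^ 2) = 0 := by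
  have h := integral_neg_eq_self (fun t : ℝ => t ^ j * Real.exp (-t ^ 2)) volume
  simp only [hj.neg_pow, neg_sq, neg_mul, integral_neg] at h
  linarith

theorem integral_euclidean_coord_pow_mul_exp (j : ℕ) :
    ∫ x : EuclideanSpace ℝ (Fin 3), x 2 ^ j * Real.exp (-‖x‖ ^ 2) =
      Real.pi * ∫ t : ℝ, t ^ j * Real.exp (-t ^ 2) := by
  rw [← (PiLp.volume_preserving_toLp (Fin 3)).integral_comp
    (MeasurableEquiv.toLp 2 _).measurableEmbedding]
  have h := integral_fintype_prod_volume_eq_prod (𝕜 := ℝ) (ι := Fin 3) (E := fun _ => ℝ)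
    ![fun t => Real.exp (-t ^ 2), fun t => Real.exp (-t ^ 2),
      fun t => t ^ j * Real.exp (-t ^ 2)]
  have hg : ∫ t : ℝ, Real.exp (-t ^ 2) = √Real.pi := by
    simpa using integral_gaussian 1
  simp only [Fin.prod_univ_three] at h
  simp only [Matrix.cons_val, hg, Real.mul_self_sqrt Real.pi_pos.le] at h
  rw [← h]
  congr 1
  ext x
  rw [EuclideanSpace.norm_sq_eq]
  simp only [Fin.sum_univ_three, Real.norm_eq_abs, sq_abs, neg_add, Real.exp_add]
  ring

/-- The Gaussian integral of `x₂ ^ j` is computed in Cartesian and in polar coordinates; `Γ (a + 1)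
= a Γ a` makes the Gamma factors cancel for even `j`, and both sides vanish for odd `j`. -/
theorem integral_sphere_coord_pow (j : ℕ) :
    ∫ ω : Sphere2, ω.1 2 ^ j ∂sphereMeasure = 2 * Real.pi * ∫ t in (-1 : ℝ)..1, t ^ j := by
  have h := integral_eq_integral_sphere_mul_radial (𝕜 := ℝ)
    (F := fun x : EuclideanSpace ℝ (Fin 3) => x 2 ^ j * Real.exp (-‖x‖ ^ 2))
    (f := fun ω => ω.1 2 ^ j) (w := fun r => r ^ j * Real.exp (-r ^ 2)) (by
      intro ω r hr
      have : ‖ω.1‖ = 1 := by simp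
      simp only [PiLp.smul_apply, smul_eq_mul, norm_smul, this, mul_pow, mul_one,
        Real.norm_eq_abs, sq_abs]
      ring)
  have hr : ∫ r in Set.Ioi (0 : ℝ), ((r : ℝ) : ℝ) ^ 2 * (r ^ j * Real.exp (-r ^ 2)) =
      Real.Gamma ((j + 1) / 2) * ((j + 1) / 2) / 2 := by
    have := integral_pow_mul_exp_neg_sq (j + 2)
    rw [show (((j + 2 : ℕ) : ℝ) + 1) / 2 = (j + 1) / 2 + 1 by push_cast; ring,
      Real.Gamma_add_one (by positivity)] at this
    rw [mul_comm (Real.Gamma _), ← this]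
    congr 1
    ext r
    ring
  have hG : 0 < Real.Gamma (((j : ℝ) + 1) / 2) := Real.Gamma_pos_of_pos (by positivity)
  have hr' : ∫ r in Set.Ioi (0 : ℝ), ((r : ℝ) : ℝ) ^ 2 * (r ^ j * Real.exp (-r ^ 2)) ≠ 0 := by
    rw [hr]; positivity
  rw [integral_euclidean_coord_pow_mul_exp] at h
  apply mul_right_cancel₀ hr'
  refine h.symm.trans ?_
  rw [hr, integral_pow]
  rcases Nat.even_or_odd j with hj | hj
  · rw [integral_pow_mul_exp_neg_sq_of_even hj, hj.add_one.neg_one_pow]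
    field_simp
    norm_num
  · rw [integral_pow_mul_exp_neg_sq_of_odd hj, hj.add_one.neg_one_pow]
    simp

instance : IsFiniteMeasure sphereMeasure := by
  unfold sphereMeasure; infer_instance

/-- Archimedes' hat-box theorem, for polynomials. -/
theorem integral_sphere_polynomial_coord (P : Polynomial ℝ) :
    ∫ ω : Sphere2, P.eval (ω.1 2) ∂sphereMeasure =
      2 * Real.pi * ∫ t in (-1 : ℝ)..1, P.eval t := by
  induction P using Polynomial.induction_on' with
  | add P Q hP hQ =>
    simp only [Polynomial.eval_add]
    rw [integral_add, intervalIntegral.integral_add, hP, hQ]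
    · ring
    · exact P.continuous.intervalIntegrable _ _
    · exact Q.continuous.intervalIntegrable _ _
    · exact (Continuous.integrable_of_hasCompactSupport (by fun_prop)
        (HasCompactSupport.of_compactSpace _))
    · exact (Continuous.integrable_of_hasCompactSupport (by fun_prop)
        (HasCompactSupport.of_compactSpace _))
  | monomial j a =>
    simp only [Polynomial.eval_monomial, integral_const_mul,
      intervalIntegral.integral_const_mul, integral_sphere_coord_pow]
    ring

theorem integral_pow_mul_one_sub_pow (a b : ℕ) :
    ∫ t in (0 : ℝ)..1, t ^ a * (1 - t) ^ b = a.factorial * b.factorial / (a + b + 1).factorial := by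
  have h := Complex.Gamma_mul_Gamma_eq_betaIntegral (s := a + 1) (t := b + 1)
    (by simp; positivity) (by simp; positivity)
  rw [Complex.Gamma_nat_eq_factorial, Complex.Gamma_nat_eq_factorial,
    show (a : ℂ) + 1 + (b + 1) = ((a + b + 1 : ℕ) : ℂ) + 1 by push_cast; ring,
    Complex.Gamma_nat_eq_factorial, Complex.betaIntegral] at h
  simp only [add_sub_cancel_right, Complex.cpow_natCast] at h
  have h2 : ∫ t in (0 : ℝ)..1, (t : ℂ) ^ a * (1 - t) ^ b =
      ((∫ t in (0 : ℝ)..1, t ^ a * (1 - t) ^ b : ℝ) : ℂ) := by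
    rw [← intervalIntegral.integral_ofReal]
    push_cast
    rfl
  rw [h2] at h
  rw [eq_div_iff (by positivity), mul_comm]
  exact_mod_cast h.symm

theorem integral_sphere_beta (a b : ℕ) :
    ∫ ω : Sphere2, ((1 + ω.1 2) / 2) ^ a * ((1 - ω.1 2) / 2) ^ b ∂sphereMeasure =
      4 * Real.pi * (a.factorial * b.factorial / (a + b + 1).factorial) := by
  have h := integral_sphere_polynomial_coord
    ((Polynomial.C (1 / 2) * (1 + Polynomial.X)) ^ a *
      (Polynomial.C (1 / 2) * (1 - Polynomial.X)) ^ b)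
  simp only [Polynomial.eval_mul, Polynomial.eval_pow, Polynomial.eval_C, Polynomial.eval_add,
    Polynomial.eval_sub, Polynomial.eval_X, Polynomial.eval_one] at h
  simp only [div_eq_inv_mul, mul_one] at h ⊢
  rw [h]
  have h3 := intervalIntegral.integral_comp_mul_add (a := -1) (b := 1)
    (fun t : ℝ => t ^ a * (1 - t) ^ b) (c := 2⁻¹) (by norm_num) 2⁻¹
  have h4 := integral_pow_mul_one_sub_pow a b
  norm_num at h3
  rw [h4] at h3
  have h5 : ∀ t : ℝ, (2⁻¹ * (1 + t)) ^ a * (2⁻¹ * (1 - t)) ^ b =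
      (1 / 2 * t + 1 / 2) ^ a * (1 - (1 / 2 * t + 1 / 2)) ^ b := by
    intro t
    congr 2 <;> ring
  simp only [h5]
  rw [h3]
  ring

/-- Rotation by the angle `α` around the third axis. -/
def axisRotation (α : ℝ) : EuclideanSpace ℝ (Fin 3) ≃ₗᵢ[ℝ] EuclideanSpace ℝ (Fin 3) :=
  LinearIsometry.toLinearIsometryEquiv
    { toFun := fun x => !₂[Real.cos α * x 0 - Real.sin α * x 1,
        Real.sin α * x 0 + Real.cos α * x 1, x 2]
      map_add' := by
        intro x y
        ext i
        fin_cases i <;> simp <;> ring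
      map_smul' := by
        intro c x
        ext i
        fin_cases i <;> simp <;> ring
      norm_map' := by
        intro x
        simp only [EuclideanSpace.norm_eq, LinearMap.coe_mk, AddHom.coe_mk, Fin.sum_univ_three,
          Real.norm_eq_abs, sq_abs]
        congr 1
        simp
        linear_combination (x 0 ^ 2 + x 1 ^ 2) * Real.sin_sq_add_cos_sq α } rfl

theorem axisRotation_apply (α : ℝ) (x : EuclideanSpace ℝ (Fin 3)) :
    axisRotation α x = !₂[Real.cos α * x 0 - Real.sin α * x 1,
        Real.sin α * x 0 + Real.cos α * x 1, x 2] := rfl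

/-- Extend `F` to be homogeneous of degree zero, multiply by a Gaussian, and use that isometries
preserve volume and norm. -/
theorem integral_sphere_comp_isometry
    (R : EuclideanSpace ℝ (Fin 3) ≃ₗᵢ[ℝ] EuclideanSpace ℝ (Fin 3))
    (F : EuclideanSpace ℝ (Fin 3) → ℂ) :
    ∫ ω : Sphere2, F (R ω.1) ∂sphereMeasure = ∫ ω : Sphere2, F ω.1 ∂sphereMeasure := by
  have key : ∀ G : EuclideanSpace ℝ (Fin 3) → ℂ,
      ∫ x : EuclideanSpace ℝ (Fin 3), G (‖x‖⁻¹ • x) * (Real.exp (-‖x‖ ^ 2) : ℂ) =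
        (∫ ω : Sphere2, G ω.1 ∂sphereMeasure) *
          ∫ r in Set.Ioi (0 : ℝ), (r : ℂ) ^ 2 * (Real.exp (-r ^ 2) : ℂ) := by
    intro G
    refine integral_eq_integral_sphere_mul_radial (𝕜 := ℂ)
      (w := fun r => (Real.exp (-r ^ 2) : ℂ)) fun ω r hr => ?_
    have : ‖ω.1‖ = 1 := by simp
    simp only [norm_smul, this, mul_one, Real.norm_eq_abs, abs_of_pos hr,
      inv_smul_smul₀ hr.ne']
  have hne : ∫ r in Set.Ioi (0 : ℝ), (r : ℂ) ^ 2 * (Real.exp (-r ^ 2) : ℂ) ≠ 0 := by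
    have h := integral_pow_mul_exp_neg_sq 2
    have hG : 0 < Real.Gamma (((2 : ℕ) + 1 : ℝ) / 2) := Real.Gamma_pos_of_pos (by positivity)
    have : ∫ r in Set.Ioi (0 : ℝ), (r : ℂ) ^ 2 * (Real.exp (-r ^ 2) : ℂ) =
        ((∫ r in Set.Ioi (0 : ℝ), r ^ 2 * Real.exp (-r ^ 2) : ℝ) : ℂ) := by
      refine Eq.trans ?_ (integral_ofReal (𝕜 := ℂ))
      simp only [RCLike.ofReal_eq_complex_ofReal, Complex.ofReal_mul, Complex.ofReal_pow]
    rw [this, h]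
    exact_mod_cast (by positivity)
  apply mul_right_cancel₀ hne
  rw [← key F, ← key fun x => F (R x)]
  rw [← R.measurePreserving.integral_comp R.toHomeomorph.measurableEmbedding
    (fun x => F (‖x‖⁻¹ • x) * (Real.exp (-‖x‖ ^ 2) : ℂ))]
  simp

/-- Rotation by `π / m` about the third axis multiplies `(x₀ + i x₁) ^ m` by `e^{iπ} = -1` and fixes
`x₂`, so the integral equals its negative. -/
theorem integral_sphere_pow_mul_eq_zero {m : ℕ} (hm : m ≠ 0) (g : ℝ → ℂ) :
    ∫ ω : Sphere2, (⟨ω.1 0, ω.1 1⟩ : ℂ) ^ m * g (ω.1 2) ∂sphereMeasure = 0 := by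
  have h := integral_sphere_comp_isometry (axisRotation (Real.pi / m))
    fun x => (⟨x 0, x 1⟩ : ℂ) ^ m * g (x 2)
  have hz : ∀ x : EuclideanSpace ℝ (Fin 3),
      (⟨axisRotation (Real.pi / m) x 0, axisRotation (Real.pi / m) x 1⟩ : ℂ) ^ m =
        -(⟨x 0, x 1⟩ : ℂ) ^ m := by
    intro x
    have h1 : (⟨axisRotation (Real.pi / m) x 0, axisRotation (Real.pi / m) x 1⟩ : ℂ) =
        Complex.exp ((Real.pi / m : ℝ) * Complex.I) * ⟨x 0, x 1⟩ := by
      apply Complex.ext <;>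
        simp only [axisRotation_apply, Complex.mul_re, Complex.mul_im,
          Complex.exp_ofReal_mul_I_re, Complex.exp_ofReal_mul_I_im] <;> simp
      all_goals ring
    rw [h1, mul_pow, ← Complex.exp_nat_mul]
    have : (m : ℂ) * ((Real.pi / m : ℝ) * Complex.I) = Real.pi * Complex.I := by
      push_cast
      field_simp
    rw [this, Complex.exp_pi_mul_I]
    ring
  have h2 : ∀ x : EuclideanSpace ℝ (Fin 3), axisRotation (Real.pi / m) x 2 = x 2 :=
    fun x => rfl
  simp only [hz, h2, neg_mul, integral_neg] at h
  exact self_eq_neg.1 h.symm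

/-! ### Spin coherent states of a single spin -/

/-- Uniqueness for the linear equation `v' = X v`: the derivative of `exp (-t X) v(t)` vanishes. -/
theorem exp_smul_apply_of_hasDerivAt {E : Type*} [NormedAddCommGroup E] [NormedSpace ℂ E]
    [CompleteSpace E] (X : E →L[ℂ] E) {v : ℂ → E} (hv : ∀ t, HasDerivAt v (X (v t)) t) (t : ℂ) :
    NormedSpace.exp (t • X) (v 0) = v t := by
  have hd : ∀ t, HasDerivAt (fun u => NormedSpace.exp (u • -X) (v u)) 0 t := by
    intro t
    have h := (hasDerivAt_exp_smul_const (𝕂 := ℂ) (-X) t).clm_apply (hv t)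
    refine h.congr_deriv ?_
    simp
  have hc : NormedSpace.exp (t • -X) (v t) = v 0 := by
    have := is_const_of_deriv_eq_zero (fun u => (hd u).differentiableAt)
      (fun u => (hd u).deriv) t 0
    simpa using this
  let _ : NormedAlgebra ℚ (E →L[ℂ] E) := .restrictScalars ℚ ℂ _
  rw [← hc, ← mul_apply_eq_comp, ← NormedSpace.exp_add_of_commute]
  · simp
  · exact ((Commute.refl X).neg_right.smul_left t).smul_right t

theorem toEuclideanCLM_exp {ι : Type*} [Fintype ι] [DecidableEq ι] (A : Matrix ι ι ℂ) :
    Matrix.toEuclideanCLM (𝕜 := ℂ) (NormedSpace.exp A) =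
      NormedSpace.exp (Matrix.toEuclideanCLM (n := ι) (𝕜 := ℂ) A) := by
  open scoped Matrix.Norms.L2Operator in
  let _ : NormedAlgebra ℚ (Matrix ι ι ℂ) := .restrictScalars ℚ ℂ _
  let _ : NormedAlgebra ℚ (EuclideanSpace ℂ ι →L[ℂ] EuclideanSpace ℂ ι) :=
    .restrictScalars ℚ ℂ _
  exact NormedSpace.map_exp (Matrix.toEuclideanCLM (n := ι) (𝕜 := ℂ))
    (LinearMap.continuous_of_finiteDimensional
      ((Matrix.toEuclideanCLM (n := ι) (𝕜 := ℂ)).toAlgEquiv.toLinearMap)) A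

/-- The vector with components `√(n choose k) a^(n - k) b^k`: the symmetric tensor power of the
spinor `(a, b)`. -/
def spinorPower (n : ℕ) (a b : ℂ) (k : Fin (n + 1)) : ℂ :=
  (√(n.choose k) : ℝ) * (a ^ (n - (k : ℕ)) * b ^ (k : ℕ))

/-- Here `(k + 1) (n - k)` is the radicand `s (s + 1) - m (m - 1)` of the ladder coefficient at `m =
s - k`. -/
theorem sqrt_choose_succ {n k : ℕ} (hk : k < n) :
    √(n.choose (k + 1) : ℝ) * (k + 1) = √((k + 1) * (n - k)) * √(n.choose k : ℝ) := by
  have hkn : (k : ℝ) < n := by exact_mod_cast hk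
  rw [← Real.sqrt_sq (by positivity : (0 : ℝ) ≤ k + 1), ← Real.sqrt_mul (by positivity),
    ← Real.sqrt_mul (mul_nonneg (by positivity) (by linarith))]
  have h : (n.choose (k + 1) : ℝ) * (k + 1) = n.choose k * (n - k) := by
    have := n.choose_succ_right_eq k
    rw [← Nat.cast_sub hk.le]
    exact_mod_cast this
  congr 1
  rw [Real.sqrt_sq (by positivity)]
  linear_combination (k + 1 : ℝ) * h

theorem sqrt_choose_mul {n k : ℕ} (hk : k < n) :
    √(n.choose k : ℝ) * (n - k) = √((k + 1) * (n - k)) * √(n.choose (k + 1) : ℝ) := by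
  have hkn : (k : ℝ) < n := by exact_mod_cast hk
  have h := sqrt_choose_succ hk
  have h2 : √((k + 1 : ℝ) * (n - k)) * √((k + 1 : ℝ) * (n - k)) = (k + 1) * (n - k) :=
    Real.mul_self_sqrt (mul_nonneg (by positivity) (by linarith))
  apply mul_right_cancel₀ (by positivity : (k + 1 : ℝ) ≠ 0)
  linear_combination -√((k + 1 : ℝ) * (n - k)) * h - √(n.choose k : ℝ) * h2

/-- On symmetric powers `s₋` acts as `a ∂/∂b`, and below `s₊` acts as `b ∂/∂a`. Truncated exponents
at `k = 0` and `k = n` are harmless, as their coefficients vanish. -/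
theorem spinMinus_mulVec_spinorPower (n : ℕ) (a b : ℂ) (k : Fin (n + 1)) :
    (spinMinus n).mulVec (spinorPower n a b) k =
      (√(n.choose k) : ℝ) * (k * a ^ (n + 1 - (k : ℕ)) * b ^ ((k : ℕ) - 1)) := by
  obtain ⟨k, hk⟩ := k
  simp only [Matrix.mulVec, dotProduct, spinMinus, Matrix.of_apply, ite_mul, zero_mul]
  rcases k with _ | k
  · simp
  · rw [Finset.sum_eq_single ⟨k, by omega⟩]
    · have h := congrArg (fun x : ℝ => (x : ℂ)) (sqrt_choose_succ (n := n) (k := k) (by omega))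
      have hm : spin n * (spin n + 1) - magnetic n ⟨k, by omega⟩ * (magnetic n ⟨k, by omega⟩ - 1) =
          (k + 1) * (n - k) := by
        simp only [spin, magnetic]
        ring
      simp only [if_true, hm, spinorPower, Nat.add_sub_add_right, Nat.add_sub_cancel]
      push_cast at h ⊢
      linear_combination -a ^ (n - k) * b ^ k * h
    · intro l _ hl
      rw [if_neg]
      rintro h
      exact hl (Fin.ext (by simpa using h.symm))
    · simp

theorem spinPlus_mulVec_spinorPower (n : ℕ) (a b : ℂ) (k : Fin (n + 1)) :
    (spinPlus n).mulVec (spinorPower n a b) k =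
      (√(n.choose k) : ℝ) * ((n - k) * a ^ (n - (k : ℕ) - 1) * b ^ ((k : ℕ) + 1)) := by
  obtain ⟨k, hk⟩ := k
  simp only [Matrix.mulVec, dotProduct, spinPlus, Matrix.of_apply, ite_mul, zero_mul]
  rcases Nat.lt_succ_iff_lt_or_eq.1 hk with hk' | rfl
  · rw [Finset.sum_eq_single ⟨k + 1, by omega⟩]
    · have h := congrArg (fun x : ℝ => (x : ℂ)) (sqrt_choose_mul (n := n) (k := k) (by omega))
      have hm : spin n * (spin n + 1) -
          magnetic n ⟨k + 1, by omega⟩ * (magnetic n ⟨k + 1, by omega⟩ + 1) =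
          (k + 1) * (n - k) := by
        simp only [spin, magnetic]
        push_cast
        ring
      simp only [if_true, hm, spinorPower, Nat.sub_sub]
      push_cast at h ⊢
      linear_combination -a ^ (n - (k + 1)) * b ^ (k + 1) * h
    · intro l _ hl
      rw [if_neg]
      rintro h
      exact hl (Fin.ext (by simpa using h.symm))
    · simp
  · rw [Finset.sum_eq_zero]
    · simp
    · intro l _
      rw [if_neg]
      have := l.2
      omega

/-- Along `(a, b) = (cos t, z sin t)` the chain rule gives `-sin t ∂_a + z cos t ∂_b = z a ∂_b - z'
b ∂_a`, the generator of the rotation. -/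
theorem hasDerivAt_spinorPower (n : ℕ) {z z' : ℂ} (hz : z * z' = 1) (t : ℂ) :
    HasDerivAt (fun t => WithLp.toLp 2 (spinorPower n (Complex.cos t) (z * Complex.sin t)))
      (Matrix.toEuclideanCLM (𝕜 := ℂ) (z • spinMinus n - z' • spinPlus n)
        (WithLp.toLp 2 (spinorPower n (Complex.cos t) (z * Complex.sin t)))) t := by
  rw [Matrix.toEuclideanCLM_toLp, Matrix.sub_mulVec, Matrix.smul_mulVec, Matrix.smul_mulVec]
  refine (PiLp.continuousLinearEquiv 2 ℂ (fun _ : Fin (n + 1) => ℂ)).symm.hasFDerivAt.comp_hasDerivAt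
    t (hasDerivAt_pi.2 fun k => ?_)
  have h := (((Complex.hasDerivAt_cos t).pow (n - (k : ℕ))).mul
    (((Complex.hasDerivAt_sin t).const_mul z).pow (k : ℕ))).const_mul
      (((√(n.choose k) : ℝ)) : ℂ)
  refine h.congr_deriv ?_
  simp only [Pi.sub_apply, Pi.smul_apply, smul_eq_mul, spinMinus_mulVec_spinorPower,
    spinPlus_mulVec_spinorPower]
  have hk : (k : ℕ) ≤ n := by omega
  rw [Nat.cast_sub hk, Nat.succ_sub hk, pow_succ (Complex.cos t), pow_succ (z * Complex.sin t)]
  simp only [Pi.pow_apply]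
  linear_combination (√(n.choose k) : ℝ) * (n - (k : ℂ)) *
    Complex.cos t ^ (n - (k : ℕ) - 1) * (z * Complex.sin t) ^ (k : ℕ) * Complex.sin t * hz

/-- The component `cos (θ / 2)` of the spin-`1/2` coherent state. -/
def upAmplitude (Ω : Sphere2) : ℝ := Real.cos (polar Ω / 2)

/-- The component `e^{iφ} sin (θ / 2)` of the spin-`1/2` coherent state. -/
def downAmplitude (Ω : Sphere2) : ℂ :=
  Complex.exp (Complex.I * (azimuth Ω : ℂ)) * (Real.sin (polar Ω / 2) : ℝ)

theorem rotation_mulVec_single (n : ℕ) (Ω : Sphere2) :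
    (rotation n Ω).mulVec (Pi.single 0 1) =
      spinorPower n (upAmplitude Ω) (downAmplitude Ω) := by
  have hz : Complex.exp (Complex.I * (azimuth Ω : ℂ)) *
      Complex.exp (-(Complex.I * (azimuth Ω : ℂ))) = 1 := by
    rw [← Complex.exp_add]; simp
  have h := exp_smul_apply_of_hasDerivAt _ (hasDerivAt_spinorPower n hz) (polar Ω / 2 : ℝ)
  rw [← map_smul, ← toEuclideanCLM_exp, Matrix.toEuclideanCLM_toLp] at h
  have h0 : spinorPower n (Complex.cos 0)
      (Complex.exp (Complex.I * (azimuth Ω : ℂ)) * Complex.sin 0) = Pi.single 0 1 := by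
    ext k
    rcases eq_or_ne k 0 with rfl | hk
    · simp [spinorPower]
    · have : (k : ℕ) ≠ 0 := fun h => hk (Fin.ext h)
      simp [spinorPower, hk, this]
  rw [h0] at h
  have h1 := congrArg WithLp.ofLp h
  simp only at h1
  rw [rotation, h1, upAmplitude, downAmplitude, Complex.ofReal_cos, Complex.ofReal_sin]

theorem sphere_coord_sq_sum (Ω : Sphere2) : Ω.1 0 ^ 2 + Ω.1 1 ^ 2 + Ω.1 2 ^ 2 = 1 := by
  have h : ‖Ω.1‖ = 1 := by simp
  have := EuclideanSpace.norm_sq_eq Ω.1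
  rw [h, Fin.sum_univ_three] at this
  simpa using this.symm

theorem cos_polar (Ω : Sphere2) : Real.cos (polar Ω) = Ω.1 2 := by
  have h := sphere_coord_sq_sum Ω
  exact Real.cos_arccos (by nlinarith [sq_nonneg (Ω.1 0), sq_nonneg (Ω.1 1)])
    (by nlinarith [sq_nonneg (Ω.1 0), sq_nonneg (Ω.1 1)])

theorem upAmplitude_sq (Ω : Sphere2) : upAmplitude Ω ^ 2 = (1 + Ω.1 2) / 2 := by
  rw [upAmplitude, Real.cos_sq, mul_div_cancel₀ _ two_ne_zero, cos_polar]
  ring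

theorem downAmplitude_mul_conj (Ω : Sphere2) :
    downAmplitude Ω * star (downAmplitude Ω) = (((1 - Ω.1 2) / 2 : ℝ) : ℂ) := by
  have h : Real.sin (polar Ω / 2) ^ 2 = (1 - Ω.1 2) / 2 := by
    rw [Real.sin_sq, ← upAmplitude, upAmplitude_sq]
    ring
  rw [← h, downAmplitude, Complex.star_def, Complex.mul_conj, Complex.normSq_eq_norm_sq, norm_mul,
    mul_comm Complex.I, Complex.norm_exp_ofReal_mul_I, one_mul, Complex.norm_real, Real.norm_eq_abs,
    sq_abs]

/-- The azimuth jumps, but quadratic expressions in the spinor are polynomial in `Ω`. This is the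
source of continuity of the symbols, poles included. -/
theorem two_mul_upAmplitude_mul_downAmplitude (Ω : Sphere2) :
    2 * (upAmplitude Ω : ℂ) * downAmplitude Ω = ⟨Ω.1 0, Ω.1 1⟩ := by
  have h : 2 * Real.sin (polar Ω / 2) * Real.cos (polar Ω / 2) = ‖(⟨Ω.1 0, Ω.1 1⟩ : ℂ)‖ := by
    rw [← Real.sin_two_mul, mul_div_cancel₀ _ two_ne_zero, polar, Real.sin_arccos,
      Complex.norm_eq_sqrt_sq_add_sq]
    congr 1
    linarith [sphere_coord_sq_sum Ω]
  rw [← Complex.norm_mul_exp_arg_mul_I ⟨Ω.1 0, Ω.1 1⟩, ← h, upAmplitude, downAmplitude, azimuth,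
    mul_comm Complex.I]
  push_cast
  ring

/-- The component of the spin in the direction `Ω`, applied to the coherent state `|Ω⟩`. -/
theorem sum_spinOp_mulVec_spinorPower (n : ℕ) (Ω : Sphere2) :
    (∑ i, (Ω.1 i : ℂ) • spinOp n i).mulVec
        (spinorPower n (upAmplitude Ω) (downAmplitude Ω)) =
      (spin n : ℂ) • spinorPower n (upAmplitude Ω) (downAmplitude Ω) := by
  have ha : (upAmplitude Ω : ℂ) ^ 2 = (1 + Ω.1 2) / 2 := by
    rw [← Complex.ofReal_pow, upAmplitude_sq]
    push_cast
    rfl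
  have hb := downAmplitude_mul_conj Ω
  have hw := two_mul_upAmplitude_mul_downAmplitude Ω
  have hw' := congrArg star hw
  simp only [star_mul', Complex.star_def, Complex.conj_ofReal, map_ofNat] at hw' hb
  have e1 : (⟨Ω.1 0, Ω.1 1⟩ : ℂ) = Ω.1 0 + Ω.1 1 * Complex.I := by
    apply Complex.ext <;> simp
  have e2 : (starRingEnd ℂ) (⟨Ω.1 0, Ω.1 1⟩ : ℂ) = Ω.1 0 - Ω.1 1 * Complex.I := by
    apply Complex.ext <;> simp
  rw [e2] at hw'
  rw [e1] at hw
  -- In ladder form the coefficients of `s₊` and `s₋` are the conjugate of `a b` and `a b` itself,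
  -- so the claim reduces to an identity between monomials.
  have hS : ∑ i, (Ω.1 i : ℂ) • spinOp n i =
      ((Ω.1 0 - Ω.1 1 * Complex.I) / 2) • spinPlus n +
        ((Ω.1 0 + Ω.1 1 * Complex.I) / 2) • spinMinus n +
        (Ω.1 2 : ℂ) • Matrix.diagonal fun k => ((magnetic n k : ℝ) : ℂ) := by
    have hI : 1 / (2 * Complex.I) = -Complex.I / 2 := by
      field_simp
      simp
    simp only [Fin.sum_univ_three, spinOp, Matrix.cons_val, hI]
    module
  rw [hS]
  ext k
  simp only [Matrix.add_mulVec, Matrix.smul_mulVec, Pi.add_apply, Pi.smul_apply, smul_eq_mul,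
    spinMinus_mulVec_spinorPower, spinPlus_mulVec_spinorPower, Matrix.mulVec_diagonal]
  rw [← hw, ← hw']
  generalize upAmplitude Ω = a at *
  generalize downAmplitude Ω = b at *
  have hk : (k : ℕ) ≤ n := by omega
  simp only [spinorPower, spin, magnetic]
  push_cast at hb ⊢
  generalize (starRingEnd ℂ) b = b' at *
  have h1 : (n - (k : ℂ)) * (a : ℂ) ^ (n - (k : ℕ) - 1) * a = (n - k) * (a : ℂ) ^ (n - (k : ℕ)) := by
    rcases hk.lt_or_eq with hk' | hk'
    · rw [mul_assoc, ← pow_succ]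
      congr 2
      omega
    · simp [hk']
  have h2 : ((k : ℕ) : ℂ) * b ^ ((k : ℕ) - 1) * b = (k : ℕ) * b ^ (k : ℕ) := by
    rcases Nat.eq_zero_or_pos (k : ℕ) with hk' | hk'
    · simp [hk']
    · rw [mul_assoc, ← pow_succ]
      congr 2
      omega
  rw [Nat.succ_sub hk, pow_succ (a : ℂ), pow_succ b]
  generalize b ^ ((k : ℕ) - 1) = B at *
  generalize (a : ℂ) ^ (n - (k : ℕ) - 1) = A at *
  generalize b ^ (k : ℕ) = B' at *
  generalize (a : ℂ) ^ (n - (k : ℕ)) = A' at *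
  linear_combination (√(n.choose k) : ℝ) * (b' * B' * b * h1 + a ^ 2 * A' * h2 +
    A' * B' * (n - k) * hb + A' * B' * k * ha)

/-- The binomial theorem for `(|b|² + |a|²) ^ n = 1`. -/
theorem sum_star_spinorPower_mul (n : ℕ) (Ω : Sphere2) :
    ∑ k, star (spinorPower n (upAmplitude Ω) (downAmplitude Ω) k) *
      spinorPower n (upAmplitude Ω) (downAmplitude Ω) k = 1 := by
  have hb := downAmplitude_mul_conj Ω
  have ha : (upAmplitude Ω : ℂ) ^ 2 = (1 + Ω.1 2) / 2 := by
    rw [← Complex.ofReal_pow, upAmplitude_sq]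
    push_cast
    rfl
  have h := add_pow (downAmplitude Ω * star (downAmplitude Ω)) ((upAmplitude Ω : ℂ) ^ 2) n
  rw [hb, ha] at h
  rw [show (((1 - Ω.1 2) / 2 : ℝ) : ℂ) + (1 + Ω.1 2) / 2 = 1 by push_cast; ring, one_pow,
    Finset.sum_range] at h
  rw [h, ← hb, ← ha]
  refine Finset.sum_congr rfl fun k _ => ?_
  have hs : ((√(n.choose k) : ℝ) : ℂ) * (√(n.choose k) : ℝ) = n.choose k := by
    rw [← Complex.ofReal_mul, Real.mul_self_sqrt (by positivity)]
    simp
  simp only [spinorPower, star_mul', star_pow, Complex.star_def, Complex.conj_ofReal]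
  rw [← hs]
  ring

/-! ### Coherent states of several spins and the resolution of the identity -/

/-- The matrix elements `⟨Ω|k⟩⟨l|Ω⟩` of the coherent projection of a single spin. -/
def coherentKernel (n : ℕ) (k l : Fin (n + 1)) (Ω : Sphere2) : ℂ :=
  star (spinorPower n (upAmplitude Ω) (downAmplitude Ω) k) *
    spinorPower n (upAmplitude Ω) (downAmplitude Ω) l

theorem star_coherentKernel (n : ℕ) (k l : Fin (n + 1)) (Ω : Sphere2) :
    star (coherentKernel n k l Ω) = coherentKernel n l k Ω := by
  simp [coherentKernel, mul_comm]

/-- The azimuth enters only through the power of `Ω₀ + i Ω₁`. This gives both continuity and the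
vanishing of the off-diagonal integrals. -/
theorem coherentKernel_of_le {n : ℕ} {k l : Fin (n + 1)} (h : k ≤ l) (Ω : Sphere2) :
    coherentKernel n k l Ω = (⟨Ω.1 0, Ω.1 1⟩ : ℂ) ^ ((l : ℕ) - k) *
      ((√(n.choose k) * √(n.choose l) * (1 / 2) ^ ((l : ℕ) - k) *
        (((1 + Ω.1 2) / 2) ^ (n - (l : ℕ)) * ((1 - Ω.1 2) / 2) ^ (k : ℕ)) : ℝ) : ℂ) := by
  have h2 : (1 / 2 : ℂ) ^ ((l : ℕ) - k) * 2 ^ ((l : ℕ) - k) = 1 := by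
    rw [← mul_pow]; norm_num
  rw [← two_mul_upAmplitude_mul_downAmplitude, ← upAmplitude_sq]
  simp only [Complex.ofReal_mul, Complex.ofReal_pow]
  rw [← downAmplitude_mul_conj]
  simp only [coherentKernel, spinorPower, star_mul', star_pow, Complex.star_def,
    Complex.conj_ofReal]
  have h1 : (k : ℕ) ≤ l := h
  have hl : (l : ℕ) ≤ n := by omega
  have ea : (upAmplitude Ω : ℂ) ^ (n - (k : ℕ)) =
      (upAmplitude Ω : ℂ) ^ (n - (l : ℕ)) * (upAmplitude Ω : ℂ) ^ ((l : ℕ) - k) := by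
    rw [← pow_add]; congr 1; omega
  have eb : downAmplitude Ω ^ (l : ℕ) =
      downAmplitude Ω ^ (k : ℕ) * downAmplitude Ω ^ ((l : ℕ) - k) := by
    rw [← pow_add]; congr 1; omega
  rw [ea, eb, mul_pow, mul_pow, mul_pow]
  push_cast
  linear_combination -(√(n.choose k) : ℂ) * (√(n.choose l) : ℂ) *
    ((upAmplitude Ω : ℂ) ^ (n - (l : ℕ))) ^ 2 * (upAmplitude Ω : ℂ) ^ ((l : ℕ) - k) *
    downAmplitude Ω ^ (k : ℕ) * downAmplitude Ω ^ ((l : ℕ) - k) *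
    (starRingEnd ℂ) (downAmplitude Ω) ^ (k : ℕ) * h2

theorem continuous_coherentKernel (n : ℕ) (k l : Fin (n + 1)) :
    Continuous (coherentKernel n k l) := by
  wlog h : k ≤ l generalizing k l
  · simp only [← funext (star_coherentKernel n l k)]
    exact (this l k (le_of_not_ge h)).star
  · simp only [funext (coherentKernel_of_le h)]
    have hw : Continuous fun Ω : Sphere2 => (⟨Ω.1 0, Ω.1 1⟩ : ℂ) := by
      have : (fun Ω : Sphere2 => (⟨Ω.1 0, Ω.1 1⟩ : ℂ)) =
          fun Ω : Sphere2 => (Ω.1 0 : ℂ) + (Ω.1 1 : ℂ) * Complex.I := by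
        ext Ω
        exact Complex.mk_eq_add_mul_I _ _
      rw [this]
      fun_prop
    fun_prop

/-- Resolution of the identity for one spin. On the diagonal, `(n choose k) k! (n - k)! / (n + 1)! =
1 / (n + 1)`. -/
theorem integral_coherentKernel (n : ℕ) (k l : Fin (n + 1)) :
    ∫ Ω, coherentKernel n k l Ω ∂sphereMeasure =
      if k = l then ((4 * Real.pi / (n + 1) : ℝ) : ℂ) else 0 := by
  have hlt : ∀ {k l : Fin (n + 1)}, k < l → ∫ Ω, coherentKernel n k l Ω ∂sphereMeasure = 0 := by
    intro k l h
    simp only [coherentKernel_of_le h.le]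
    exact integral_sphere_pow_mul_eq_zero (Nat.sub_ne_zero_of_lt h)
      fun t => ((√(n.choose k) * √(n.choose l) * (1 / 2) ^ ((l : ℕ) - k) *
        (((1 + t) / 2) ^ (n - (l : ℕ)) * ((1 - t) / 2) ^ (k : ℕ)) : ℝ) : ℂ)
  rcases lt_trichotomy k l with h | rfl | h
  · rw [if_neg h.ne, hlt h]
  · simp only [if_true, coherentKernel_of_le le_rfl, Nat.sub_self, pow_zero, one_mul, mul_one]
    rw [integral_complex_ofReal, integral_const_mul, integral_sphere_beta]
    congr 1
    have hk : (k : ℕ) ≤ n := by omega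
    rw [Nat.sub_add_cancel hk, Real.mul_self_sqrt (by positivity), Nat.factorial_succ]
    have := Nat.choose_mul_factorial_mul_factorial hk
    have h' : (n.choose k : ℝ) * (k : ℕ).factorial * (n - (k : ℕ)).factorial = n.factorial := by
      exact_mod_cast this
    push_cast
    field_simp
    linear_combination h'
  · rw [if_neg h.ne']
    simp only [← star_coherentKernel n l k, Complex.star_def]
    rw [integral_conj, hlt h, map_zero]

theorem coherentState_apply {N : ℕ} (n : ℕ) (Ω : PhaseSpace N) (k : Fin N → Fin (n + 1)) :
    coherentState n Ω k =
      ∏ μ, spinorPower n (upAmplitude (Ω μ)) (downAmplitude (Ω μ)) (k μ) := by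
  simp only [coherentState, ← rotation_mulVec_single, Matrix.mulVec_single_one]
  rfl

theorem covariantSymbol_eq_sum {N n : ℕ} (A : Operator N n) (Ω : PhaseSpace N) :
    covariantSymbol A Ω =
      ∑ k, ∑ l, A k l * ∏ μ, coherentKernel n (k μ) (l μ) (Ω μ) := by
  simp only [covariantSymbol, dotProduct, Matrix.mulVec, Finset.mul_sum, Pi.star_apply,
    coherentState_apply, coherentKernel, Finset.prod_mul_distrib, star_prod]
  refine Finset.sum_congr rfl fun k _ => Finset.sum_congr rfl fun l _ => ?_
  ring

theorem continuous_covariantSymbol {N n : ℕ} (A : Operator N n) :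
    Continuous (covariantSymbol A) := by
  rw [funext (covariantSymbol_eq_sum A)]
  have := continuous_coherentKernel n
  fun_prop

theorem integral_covariantSymbol {N n : ℕ} (A : Operator N n) :
    ∫ Ω, covariantSymbol A Ω ∂(Measure.pi fun _ : Fin N => sphereMeasure) =
      ((4 * Real.pi / (n + 1) : ℝ) : ℂ) ^ N * A.trace := by
  have hc := continuous_coherentKernel n
  have hint : ∀ k l : Fin N → Fin (n + 1), Integrable
      (fun Ω : PhaseSpace N => A k l * ∏ μ, coherentKernel n (k μ) (l μ) (Ω μ))
      (Measure.pi fun _ : Fin N => sphereMeasure) := fun k l =>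
    Continuous.integrable_of_hasCompactSupport (by fun_prop) (HasCompactSupport.of_compactSpace _)
  have hprod : ∀ k l : Fin N → Fin (n + 1),
      ∫ Ω, ∏ μ, coherentKernel n (k μ) (l μ) (Ω μ) ∂(Measure.pi fun _ : Fin N => sphereMeasure) =
        if k = l then ((4 * Real.pi / (n + 1) : ℝ) : ℂ) ^ N else 0 := by
    intro k l
    rw [integral_fintype_prod_eq_prod fun μ => coherentKernel n (k μ) (l μ)]
    simp only [integral_coherentKernel]
    rw [Finset.prod_ite_zero]
    simp only [Finset.mem_univ, forall_const, Finset.prod_const, Finset.card_univ,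
      Fintype.card_fin, funext_iff]
  simp only [covariantSymbol_eq_sum]
  rw [integral_finsetSum _ fun k _ => integrable_finsetSum _ fun l _ => hint k l, Matrix.trace,
    Finset.mul_sum]
  refine Finset.sum_congr rfl fun k _ => ?_
  rw [integral_finsetSum _ fun l _ => hint k l]
  simp only [integral_const_mul, hprod, mul_ite, mul_zero, Finset.sum_ite_eq, Finset.mem_univ,
    if_true, Matrix.diag_apply, mul_comm]

/-- The coherent state as a vector of the Hilbert space. -/
def coherentVector {N : ℕ} (n : ℕ) (Ω : PhaseSpace N) :
    EuclideanSpace ℂ (Fin N → Fin (n + 1)) := WithLp.toLp 2 (coherentState n Ω)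

theorem covariantSymbol_eq_inner {N n : ℕ} (A : Operator N n) (Ω : PhaseSpace N) :
    covariantSymbol A Ω = inner ℂ (coherentVector n Ω)
      (Matrix.toEuclideanCLM (𝕜 := ℂ) A (coherentVector n Ω)) := by
  rw [coherentVector, Matrix.toEuclideanCLM_toLp, EuclideanSpace.inner_toLp_toLp, dotProduct_comm]
  rfl

theorem covariantSymbol_one {N n : ℕ} (Ω : PhaseSpace N) :
    covariantSymbol (1 : Operator N n) Ω = 1 := by
  have h := Finset.prod_univ_sum (R := ℂ) (fun _ : Fin N => (Finset.univ : Finset (Fin (n + 1))))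
    fun μ k => coherentKernel n k k (Ω μ)
  simp only [coherentKernel, sum_star_spinorPower_mul, Finset.prod_const_one,
    Fintype.piFinset_univ] at h
  rw [h, covariantSymbol_eq_sum]
  simp [Matrix.one_apply, coherentKernel]

theorem norm_coherentVector {N : ℕ} (n : ℕ) (Ω : PhaseSpace N) : ‖coherentVector n Ω‖ = 1 := by
  have h := covariantSymbol_eq_inner (1 : Operator N n) Ω
  rw [covariantSymbol_one, map_one, one_apply_eq_self, inner_self_eq_norm_sq_to_K] at h
  have h' : ‖coherentVector n Ω‖ ^ 2 = 1 := by
    exact_mod_cast (RCLike.ofReal_injective (K := ℂ)) (by push_cast; exact h.symm)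
  exact (pow_eq_one_iff_of_nonneg (norm_nonneg _) two_ne_zero).1 h'

/-! ### Spin operators on the tensor power -/

theorem tensorOp_mulVec {N n : ℕ} (A : Fin N → Matrix (Fin (n + 1)) (Fin (n + 1)) ℂ)
    (v : Fin N → Fin (n + 1) → ℂ) :
    (tensorOp A).mulVec (fun k => ∏ μ, v μ (k μ)) = fun k => ∏ μ, (A μ).mulVec (v μ) (k μ) := by
  ext k
  simp only [Matrix.mulVec, dotProduct, tensorOp, Matrix.of_apply, ← Finset.prod_mul_distrib,
    Finset.prod_univ_sum, Fintype.piFinset_univ]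

theorem tensorOp_mul {N n : ℕ} (A B : Fin N → Matrix (Fin (n + 1)) (Fin (n + 1)) ℂ) :
    tensorOp A * tensorOp B = tensorOp fun μ => A μ * B μ := by
  ext k l
  simp only [Matrix.mul_apply, tensorOp, Matrix.of_apply, ← Finset.prod_mul_distrib,
    Finset.prod_univ_sum, Fintype.piFinset_univ]

theorem tensorOp_one {N n : ℕ} :
    tensorOp (fun _ : Fin N => (1 : Matrix (Fin (n + 1)) (Fin (n + 1)) ℂ)) = 1 := by
  ext k l
  simp only [tensorOp, Matrix.of_apply, Matrix.one_apply, Finset.prod_ite_zero]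
  simp [funext_iff]

theorem conjTranspose_tensorOp {N n : ℕ} (A : Fin N → Matrix (Fin (n + 1)) (Fin (n + 1)) ℂ) :
    (tensorOp A).conjTranspose = tensorOp fun μ => (A μ).conjTranspose := by
  ext k l
  simp [tensorOp, Matrix.conjTranspose_apply, star_prod]

/-- The operator `1 ⊗ ⋯ ⊗ B ⊗ ⋯ ⊗ 1`, as a linear function of `B`. -/
def siteEmbedding {N n : ℕ} (μ : Fin N) :
    Matrix (Fin (n + 1)) (Fin (n + 1)) ℂ →ₗ[ℂ] Operator N n where
  toFun B := tensorOp (Function.update (fun _ => 1) μ B)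
  map_add' A B := by
    ext k l
    simp only [tensorOp, Matrix.of_apply, Matrix.add_apply]
    rw [Fintype.prod_eq_mul_prod_compl μ, Fintype.prod_eq_mul_prod_compl μ,
      Fintype.prod_eq_mul_prod_compl μ]
    simp only [Function.update_self, Matrix.add_apply, add_mul]
    congr 2 <;> refine Finset.prod_congr rfl fun ν hν => ?_ <;>
      rw [Function.update_of_ne (by simpa using hν), Function.update_of_ne (by simpa using hν)]
  map_smul' c B := by
    ext k l
    simp only [tensorOp, Matrix.of_apply, Matrix.smul_apply, RingHom.id_apply, smul_eq_mul]
    rw [Fintype.prod_eq_mul_prod_compl μ, Fintype.prod_eq_mul_prod_compl μ]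
    simp only [Function.update_self, Matrix.smul_apply, smul_eq_mul, mul_assoc]
    congr 2
    refine Finset.prod_congr rfl fun ν hν => ?_
    rw [Function.update_of_ne (by simpa using hν), Function.update_of_ne (by simpa using hν)]

theorem siteEmbedding_apply {N n : ℕ} (μ : Fin N) (B : Matrix (Fin (n + 1)) (Fin (n + 1)) ℂ) :
    siteEmbedding μ B = tensorOp (Function.update (fun _ => 1) μ B) := rfl

theorem siteSpinOp_eq {N n : ℕ} (μ : Fin N) (i : Fin 3) :
    siteSpinOp n (μ, i) = siteEmbedding μ (spinOp n i) := rfl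

theorem siteEmbedding_mul {N n : ℕ} (μ : Fin N) (A B : Matrix (Fin (n + 1)) (Fin (n + 1)) ℂ) :
    siteEmbedding μ A * siteEmbedding μ B = siteEmbedding μ (A * B) := by
  simp only [siteEmbedding_apply, tensorOp_mul]
  congr 1
  ext1 ν
  rcases eq_or_ne ν μ with rfl | h <;> simp [*]

theorem siteEmbedding_one {N n : ℕ} (μ : Fin N) :
    siteEmbedding μ (1 : Matrix (Fin (n + 1)) (Fin (n + 1)) ℂ) = 1 := by
  rw [siteEmbedding_apply, Function.update_eq_self, tensorOp_one]

theorem conjTranspose_siteEmbedding {N n : ℕ} (μ : Fin N)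
    (B : Matrix (Fin (n + 1)) (Fin (n + 1)) ℂ) :
    (siteEmbedding μ B).conjTranspose = siteEmbedding μ B.conjTranspose := by
  simp only [siteEmbedding_apply, conjTranspose_tensorOp]
  congr 1
  ext1 ν
  rcases eq_or_ne ν μ with rfl | h <;> simp [*]

theorem siteEmbedding_mulVec_coherentState {N n : ℕ} (μ : Fin N)
    (B : Matrix (Fin (n + 1)) (Fin (n + 1)) ℂ) (Ω : PhaseSpace N) {c : ℂ}
    (h : B.mulVec (spinorPower n (upAmplitude (Ω μ)) (downAmplitude (Ω μ))) =
      c • spinorPower n (upAmplitude (Ω μ)) (downAmplitude (Ω μ))) :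
    (siteEmbedding μ B).mulVec (coherentState n Ω) = c • coherentState n Ω := by
  rw [funext (coherentState_apply n Ω), siteEmbedding_apply,
    tensorOp_mulVec _ fun μ => spinorPower n (upAmplitude (Ω μ)) (downAmplitude (Ω μ))]
  ext k
  simp only [Pi.smul_apply, smul_eq_mul]
  rw [Fintype.prod_eq_mul_prod_compl μ, Fintype.prod_eq_mul_prod_compl μ, Function.update_self, h,
    Pi.smul_apply, smul_eq_mul, mul_assoc]
  congr 2
  refine Finset.prod_congr rfl fun ν hν => ?_
  rw [Function.update_of_ne (by simpa using hν), Matrix.one_mulVec]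

theorem conjTranspose_spinPlus (n : ℕ) : (spinPlus n).conjTranspose = spinMinus n := by
  ext k l
  simp only [Matrix.conjTranspose_apply, spinPlus, spinMinus, Matrix.of_apply]
  by_cases h : (l : ℕ) + 1 = k
  · rw [if_pos h, if_pos h.symm, Complex.star_def, Complex.conj_ofReal]
    congr 3
    simp only [magnetic, ← h]
    push_cast
    ring
  · rw [if_neg h, if_neg (Ne.symm h), star_zero]

theorem isHermitian_spinOp (n : ℕ) (i : Fin 3) : (spinOp n i).conjTranspose = spinOp n i := by
  have h := conjTranspose_spinPlus n
  have h' : (spinMinus n).conjTranspose = spinPlus n := by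
    rw [← h, Matrix.conjTranspose_conjTranspose]
  fin_cases i
  · simp [spinOp, h, h', add_comm]
  · simp only [spinOp, Fin.mk_one, Matrix.cons_val_one, Matrix.cons_val_zero,
      Matrix.conjTranspose_smul, Matrix.conjTranspose_sub, h, h']
    rw [show star (1 / (2 * Complex.I)) = -(1 / (2 * Complex.I)) by simp, neg_smul, ← smul_neg,
      neg_sub]
  · simp only [spinOp, Matrix.cons_val, Fin.reduceFinMk, Matrix.diagonal_conjTranspose]
    congr 1
    ext k
    simp

theorem spinPlus_mul_spinMinus (n : ℕ) :
    spinPlus n * spinMinus n =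
      Matrix.diagonal fun k : Fin (n + 1) => ((((k : ℕ) + 1) * (n - (k : ℕ)) : ℝ) : ℂ) := by
  ext k l
  obtain ⟨k, hk⟩ := k
  simp only [Matrix.mul_apply, spinPlus, spinMinus, Matrix.of_apply, ite_mul, zero_mul]
  rcases Nat.lt_succ_iff_lt_or_eq.1 hk with hk' | rfl
  · rw [Finset.sum_eq_single ⟨k + 1, by omega⟩]
    · rcases eq_or_ne (⟨k, hk⟩ : Fin (n + 1)) l with rfl | hl
      · simp only [if_true, Matrix.diagonal_apply_eq]
        rw [← Complex.ofReal_mul]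
        congr 1
        have e1 : spin n * (spin n + 1) - magnetic n ⟨k + 1, by omega⟩ *
            (magnetic n ⟨k + 1, by omega⟩ + 1) = (k + 1) * (n - k) := by
          simp only [spin, magnetic]; push_cast; ring
        have e2 : spin n * (spin n + 1) - magnetic n ⟨k, hk⟩ * (magnetic n ⟨k, hk⟩ - 1) =
            (k + 1) * (n - k) := by
          simp only [spin, magnetic]; ring
        have hkn : (k : ℝ) < n := by exact_mod_cast hk'
        rw [e1, e2, Real.mul_self_sqrt (mul_nonneg (by positivity) (by linarith))]
      · rw [Matrix.diagonal_apply_ne _ hl, if_pos rfl, if_neg, mul_zero]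
        intro h
        exact hl (Fin.ext (by simpa using h))
    · intro m _ hm
      rw [if_neg]
      rintro h
      exact hm (Fin.ext (by simpa using h.symm))
    · simp
  · rw [Finset.sum_eq_zero]
    · rw [Matrix.diagonal_apply]
      simp
    · intro m _
      rw [if_neg]
      have := m.2
      omega

theorem spinMinus_mul_spinPlus (n : ℕ) :
    spinMinus n * spinPlus n =
      Matrix.diagonal fun k : Fin (n + 1) => (((k : ℕ) * (n + 1 - (k : ℕ)) : ℝ) : ℂ) := by
  ext k l
  obtain ⟨k, hk⟩ := k
  simp only [Matrix.mul_apply, spinPlus, spinMinus, Matrix.of_apply, ite_mul, zero_mul]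
  rcases k with _ | k
  · rw [Finset.sum_eq_zero]
    · rw [Matrix.diagonal_apply]
      simp
    · intro m _
      rw [if_neg]
      simp
  · rw [Finset.sum_eq_single ⟨k, by omega⟩]
    · rcases eq_or_ne (⟨k + 1, hk⟩ : Fin (n + 1)) l with rfl | hl
      · simp only [if_true, Matrix.diagonal_apply_eq]
        rw [← Complex.ofReal_mul]
        congr 1
        have e1 : spin n * (spin n + 1) - magnetic n ⟨k + 1, by omega⟩ *
            (magnetic n ⟨k + 1, by omega⟩ + 1) = (k + 1) * (n - k) := by
          simp only [spin, magnetic]; push_cast; ring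
        have e2 : spin n * (spin n + 1) - magnetic n ⟨k, by omega⟩ *
            (magnetic n ⟨k, by omega⟩ - 1) = (k + 1) * (n - k) := by
          simp only [spin, magnetic]; ring
        have hkn : (k : ℝ) < n := by exact_mod_cast (by omega : k < n)
        rw [e1, e2, Real.mul_self_sqrt (mul_nonneg (by positivity) (by linarith))]
        push_cast
        ring
      · rw [Matrix.diagonal_apply_ne _ hl, if_pos rfl, if_neg, mul_zero]
        intro h
        exact hl (Fin.ext (by simpa using h))
    · intro m _ hm
      rw [if_neg]
      rintro h
      exact hm (Fin.ext (by simpa using h.symm))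
    · simp

/-- The Casimir identity: `s₊²` and `s₋²` cancel between `s₁²` and `s₂²`, and what remains is
diagonal. -/
theorem sum_spinOp_mul_self (n : ℕ) :
    ∑ i, spinOp n i * spinOp n i = ((spin n * (spin n + 1) : ℝ) : ℂ) • 1 := by
  have hI : (1 / (2 * Complex.I)) * (1 / (2 * Complex.I)) = -(1 / 4) := by
    rw [div_mul_div_comm, mul_mul_mul_comm, Complex.I_mul_I]
    norm_num
  have h : ∑ i, spinOp n i * spinOp n i =
      (1 / 2 : ℂ) • (spinPlus n * spinMinus n + spinMinus n * spinPlus n) +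
        spinOp n 2 * spinOp n 2 := by
    rw [Fin.sum_univ_three]
    congr 1
    simp only [spinOp, Matrix.cons_val, smul_mul_smul_comm, hI]
    simp only [add_mul, mul_add, sub_mul, mul_sub]
    module
  rw [h, spinPlus_mul_spinMinus, spinMinus_mul_spinPlus]
  simp only [spinOp, Matrix.cons_val, Matrix.diagonal_mul_diagonal, Matrix.diagonal_add,
    ← Matrix.diagonal_smul, ← Matrix.diagonal_one]
  congr 1
  ext k
  simp only [Pi.smul_apply, smul_eq_mul, magnetic, spin]
  push_cast
  ring

theorem sum_siteSpinOp_mul_self {N n : ℕ} (μ : Fin N) :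
    ∑ i, siteSpinOp n (μ, i) * siteSpinOp n (μ, i) =
      ((spin n * (spin n + 1) : ℝ) : ℂ) • (1 : Operator N n) := by
  simp only [siteSpinOp_eq, siteEmbedding_mul]
  rw [← map_sum, sum_spinOp_mul_self, map_smul, siteEmbedding_one]

theorem sum_siteSpinOp_mulVec_coherentState {N : ℕ} (n : ℕ) (μ : Fin N) (Ω : PhaseSpace N) :
    (∑ i, ((Ω μ).1 i : ℂ) • siteSpinOp n (μ, i)).mulVec (coherentState n Ω) =
      (spin n : ℂ) • coherentState n Ω := by
  simp only [siteSpinOp_eq, ← map_smul, ← map_sum]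
  exact siteEmbedding_mulVec_coherentState μ _ Ω (sum_spinOp_mulVec_spinorPower n (Ω μ))

/-! ### Approximate eigenvectors -/

/-- Each term of the series past the zeroth contains a factor `B v`: use `B^(m+1) v = B^m (B v)` and
`1 / (m + 1)! ≤ 1 / m!`. -/
theorem norm_exp_apply_sub_le {E : Type*} [NormedAddCommGroup E] [NormedSpace ℂ E]
    [CompleteSpace E] [Nontrivial E] (B : E →L[ℂ] E) (v : E) :
    ‖NormedSpace.exp B v - v‖ ≤ Real.exp ‖B‖ * ‖B v‖ := by
  have h1 : HasSum (fun m : ℕ => ((m.factorial : ℂ)⁻¹ • B ^ m) v) (NormedSpace.exp B v) :=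
    (NormedSpace.exp_series_hasSum_exp' (𝕂 := ℂ) B).mapL
      (ContinuousLinearMap.apply ℂ E v)
  have h2 := (hasSum_nat_add_iff' 1).2 h1
  simp only [Finset.range_one, Finset.sum_singleton, Nat.factorial_zero, Nat.cast_one, inv_one,
    one_smul, pow_zero, one_apply_eq_self] at h2
  have h3 : HasSum (fun m : ℕ => ‖B‖ ^ m / m.factorial * ‖B v‖) (Real.exp ‖B‖ * ‖B v‖) := by
    rw [Real.exp_eq_exp_ℝ]
    exact (NormedSpace.expSeries_div_hasSum_exp ‖B‖).mul_right _
  rw [← h2.tsum_eq]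
  refine tsum_of_norm_bounded h3 fun m => ?_
  rw [smul_apply, norm_smul, pow_succ, mul_apply_eq_comp, norm_inv,
    Complex.norm_natCast, div_mul_eq_mul_div, inv_mul_eq_div]
  gcongr
  · exact ((B ^ m).le_opNorm _).trans (by gcongr; exact norm_pow_le _ _)
  · omega

/-- Scalars commute with `A`, so `exp A = e^a exp (A - a)`. The factor `e^a` costs `M` in the
exponent and `‖A - a‖ ≤ 2 M` costs the rest. -/
theorem norm_exp_apply_sub_exp_smul_le {E : Type*} [NormedAddCommGroup E] [NormedSpace ℂ E]
    [CompleteSpace E] [Nontrivial E] (A : E →L[ℂ] E) (a : ℂ) {M : ℝ} (hA : ‖A‖ ≤ M) (ha : ‖a‖ ≤ M)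
    (v : E) :
    ‖NormedSpace.exp A v - Complex.exp a • v‖ ≤ Real.exp (3 * M) * ‖A v - a • v‖ := by
  let _ : NormedAlgebra ℚ (E →L[ℂ] E) := .restrictScalars ℚ ℂ _
  have h : NormedSpace.exp A = Complex.exp a • NormedSpace.exp (A - algebraMap ℂ _ a) := by
    conv_lhs => rw [← sub_add_cancel A (algebraMap ℂ (E →L[ℂ] E) a), add_comm]
    rw [NormedSpace.exp_add_of_commute (Algebra.commutes a _), ← NormedSpace.algebraMap_exp_comm,
      ← Complex.exp_eq_exp_ℂ, Algebra.smul_def]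
  have hB : ‖A - algebraMap ℂ (E →L[ℂ] E) a‖ ≤ 2 * M := by
    refine (norm_sub_le _ _).trans ?_
    rw [norm_algebraMap']
    linarith
  rw [h, smul_apply, ← smul_sub, norm_smul, Complex.norm_exp]
  have hB' : (A - algebraMap ℂ (E →L[ℂ] E) a) v = A v - a • v := by
    simp [Algebra.algebraMap_eq_smul_one]
  calc Real.exp a.re * ‖NormedSpace.exp (A - algebraMap ℂ (E →L[ℂ] E) a) v - v‖
      ≤ Real.exp M * (Real.exp (2 * M) * ‖A v - a • v‖) := by
        gcongr
        · exact (Complex.re_le_norm a).trans ha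
        · refine (norm_exp_apply_sub_le _ v).trans ?_
          rw [hB']
          gcongr
    _ = Real.exp (3 * M) * ‖A v - a • v‖ := by
        rw [← mul_assoc, ← Real.exp_add]
        ring_nf

/-! ### Products of operators on approximate joint eigenvectors -/

section Polynomial

variable {E ι : Type*} [NormedAddCommGroup E] [NormedSpace ℂ E]

theorem norm_listProd_ofFn_le [Nontrivial E] {q : ℕ} (X : Fin q → E →L[ℂ] E) {C : ℝ}
    (hX : ∀ a, ‖X a‖ ≤ C) : ‖(List.ofFn X).prod‖ ≤ C ^ q := by
  induction q with
  | zero => simp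
  | succ q ih =>
    rw [List.ofFn_succ, List.prod_cons, pow_succ']
    exact (norm_mul_le _ _).trans (mul_le_mul (hX 0) (ih _ fun a => hX a.succ) (norm_nonneg _)
      ((norm_nonneg _).trans (hX 0)))

/-- Telescoping: replace the operators by scalars one at a time, starting next to `v`. No
commutation is needed. -/
theorem norm_listProd_ofFn_apply_sub_le {q : ℕ} (X : Fin q → E →L[ℂ] E) (x : Fin q → ℂ)
    {C ε : ℝ} (hC : 1 ≤ C) (hX : ∀ a, ‖X a‖ ≤ C) (hx : ∀ a, ‖x a‖ ≤ C) {v : E}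
    (hv : ∀ a, ‖X a v - x a • v‖ ≤ ε) :
    ‖(List.ofFn X).prod v - (∏ a, x a) • v‖ ≤ q * C ^ q * ε := by
  induction q with
  | zero => simp
  | succ q ih =>
    have hC0 : 0 ≤ C := zero_le_one.trans hC
    have hε : 0 ≤ ε := (norm_nonneg _).trans (hv 0)
    have ih' := ih (fun a => X a.succ) (fun a => x a.succ) (fun a => hX a.succ)
      (fun a => hx a.succ) fun a => hv a.succ
    have hsplit : (List.ofFn X).prod v - (∏ a, x a) • v =
        X 0 ((List.ofFn fun a : Fin q => X a.succ).prod v - (∏ a : Fin q, x a.succ) • v) +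
          (∏ a : Fin q, x a.succ) • (X 0 v - x 0 • v) := by
      rw [List.ofFn_succ, List.prod_cons, Fin.prod_univ_succ, mul_apply_eq_comp, map_sub, map_smul]
      module
    have hprod : ‖∏ a : Fin q, x a.succ‖ ≤ C ^ q := by
      rw [norm_prod]
      exact (Finset.prod_le_prod (fun _ _ => norm_nonneg _) fun a _ => hx a.succ).trans (by simp)
    rw [hsplit]
    calc _ ≤ C * (q * C ^ q * ε) + C ^ q * ε := by
          refine (norm_add_le _ _).trans (add_le_add ?_ ?_)
          · exact ((X 0).le_opNorm _).trans (mul_le_mul (hX 0) ih' (norm_nonneg _) hC0)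
          · rw [norm_smul]
            exact mul_le_mul hprod (hv 0) (norm_nonneg _) (by positivity)
      _ ≤ C * (q * C ^ q * ε) + C ^ (q + 1) * ε := by
          gcongr
          · omega
      _ = _ := by push_cast; ring

end Polynomial

/-! ### Coherent states are approximate joint eigenvectors of the scaled spin operators -/

section Spin

variable {E : Type*} [NormedAddCommGroup E] [InnerProductSpace ℂ E] [CompleteSpace E]

theorem sum_norm_sq_apply_of_sum_mul_self {S : Fin 3 → E →L[ℂ] E}
    (hS : ∀ i, IsSelfAdjoint (S i)) {c : ℝ} (hc : ∑ i, S i * S i = (c : ℂ) • 1) (v : E) :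
    ∑ i, ‖S i v‖ ^ 2 = c * ‖v‖ ^ 2 := by
  have h : ∀ i, ((‖S i v‖ ^ 2 : ℝ) : ℂ) = inner ℂ v ((S i * S i) v) := by
    intro i
    have h1 := ContinuousLinearMap.adjoint_inner_right (S i) v (S i v)
    rw [(hS i).adjoint_eq] at h1
    rw [mul_apply_eq_comp, h1, inner_self_eq_norm_sq_to_K]
    push_cast
    rfl
  have h2 : ((∑ i, ‖S i v‖ ^ 2 : ℝ) : ℂ) = ((c * ‖v‖ ^ 2 : ℝ) : ℂ) := by
    rw [Complex.ofReal_sum]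
    simp only [h]
    rw [← inner_sum, ← sum_apply, hc, smul_apply,
      one_apply_eq_self, inner_smul_right, inner_self_eq_norm_sq_to_K]
    push_cast
    rfl
  exact_mod_cast h2

theorem sum_norm_sq_apply_sub {S : Fin 3 → E →L[ℂ] E} (hS : ∀ i, IsSelfAdjoint (S i)) {s : ℝ}
    (hc : ∑ i, S i * S i = ((s * (s + 1) : ℝ) : ℂ) • 1) {x : Fin 3 → ℝ} (hx : ∑ i, x i ^ 2 = 1)
    {v : E} (hv : ‖v‖ = 1) (hvx : ∑ i, (x i : ℂ) • S i v = (s : ℂ) • v) :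
    ∑ i, ‖S i v - ((s * x i : ℝ) : ℂ) • v‖ ^ 2 = s := by
  have h1 := sum_norm_sq_apply_of_sum_mul_self hS hc v
  have h2 : ∑ i, x i * RCLike.re (inner ℂ (S i v) v) = s := by
    have := congrArg (fun u => RCLike.re (inner ℂ u v)) hvx
    simp only [sum_inner, inner_smul_left, Complex.conj_ofReal, inner_self_eq_norm_sq_to_K, hv,
      map_sum] at this
    simpa using this
  simp only [@norm_sub_sq ℂ, inner_smul_right, norm_smul, hv, Complex.norm_real, mul_one,
    Real.norm_eq_abs, sq_abs]
  have h3 : ∀ i, RCLike.re (((s * x i : ℝ) : ℂ) * inner ℂ (S i v) v) =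
      s * (x i * RCLike.re (inner ℂ (S i v) v)) := by
    intro i
    rw [RCLike.re_eq_complex_re, Complex.re_ofReal_mul, mul_assoc]
  simp only [h3, Finset.sum_add_distrib, Finset.sum_sub_distrib, ← Finset.mul_sum, h2, mul_pow, hx,
    h1, hv]
  ring

theorem norm_sq_apply_sub_le {S : Fin 3 → E →L[ℂ] E} (hS : ∀ i, IsSelfAdjoint (S i)) {s : ℝ}
    (hc : ∑ i, S i * S i = ((s * (s + 1) : ℝ) : ℂ) • 1) {x : Fin 3 → ℝ} (hx : ∑ i, x i ^ 2 = 1)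
    {v : E} (hv : ‖v‖ = 1) (hvx : ∑ i, (x i : ℂ) • S i v = (s : ℂ) • v) (i : Fin 3) :
    ‖S i v - ((s * x i : ℝ) : ℂ) • v‖ ^ 2 ≤ s := by
  exact (Finset.single_le_sum (f := fun i => ‖S i v - ((s * x i : ℝ) : ℂ) • v‖ ^ 2)
    (fun _ _ => sq_nonneg _) (Finset.mem_univ i)).trans_eq
    (sum_norm_sq_apply_sub hS hc hx hv hvx)

theorem norm_sq_apply_le {S : Fin 3 → E →L[ℂ] E}
    (hS : ∀ i, IsSelfAdjoint (S i)) {c : ℝ} (hc : ∑ i, S i * S i = (c : ℂ) • 1) (v : E)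
    (i : Fin 3) : ‖S i v‖ ^ 2 ≤ c * ‖v‖ ^ 2 := by
  rw [← sum_norm_sq_apply_of_sum_mul_self hS hc]
  exact Finset.single_le_sum (f := fun i => ‖S i v‖ ^ 2) (fun _ _ => sq_nonneg _)
    (Finset.mem_univ i)

end Spin

/-- The operator `s_{μ,i}` as a continuous linear map. -/
def siteSpinCLM {N : ℕ} (n : ℕ) (j : Fin N × Fin 3) :
    EuclideanSpace ℂ (Fin N → Fin (n + 1)) →L[ℂ] EuclideanSpace ℂ (Fin N → Fin (n + 1)) :=
  Matrix.toEuclideanCLM (𝕜 := ℂ) (siteSpinOp n j)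

theorem isSelfAdjoint_siteSpinCLM {N : ℕ} (n : ℕ) (j : Fin N × Fin 3) :
    IsSelfAdjoint (siteSpinCLM n j) := by
  have h : IsSelfAdjoint (siteSpinOp n j) := by
    rw [IsSelfAdjoint, Matrix.star_eq_conjTranspose]
    obtain ⟨μ, i⟩ := j
    rw [siteSpinOp_eq, conjTranspose_siteEmbedding, isHermitian_spinOp]
  exact h.map _

theorem sum_siteSpinCLM_mul_self {N : ℕ} (n : ℕ) (μ : Fin N) :
    ∑ i, siteSpinCLM n (μ, i) * siteSpinCLM n (μ, i) =
      ((spin n * (spin n + 1) : ℝ) : ℂ) • 1 := by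
  simp only [siteSpinCLM, ← map_mul, ← map_sum]
  rw [sum_siteSpinOp_mul_self, map_smul, map_one]

theorem sum_siteSpinCLM_coherentVector {N : ℕ} (n : ℕ) (μ : Fin N) (Ω : PhaseSpace N) :
    ∑ i, ((Ω μ).1 i : ℂ) • siteSpinCLM n (μ, i) (coherentVector n Ω) =
      (spin n : ℂ) • coherentVector n Ω := by
  have h := congrArg (WithLp.toLp 2) (sum_siteSpinOp_mulVec_coherentState n μ Ω)
  rw [← Matrix.toEuclideanCLM_toLp, map_sum] at h
  simp only [map_smul, sum_apply, smul_apply] at h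
  exact h

theorem toEuclideanCLM_scaledSpinOp {N : ℕ} (n : ℕ) (j : Fin N × Fin 3) :
    Matrix.toEuclideanCLM (𝕜 := ℂ) (scaledSpinOp n j) = ((spin n : ℂ))⁻¹ • siteSpinCLM n j := by
  rw [scaledSpinOp, map_smul, siteSpinCLM]

theorem norm_toEuclideanCLM_scaledSpinOp_le {N n : ℕ} (hn : n ≠ 0) (j : Fin N × Fin 3) :
    ‖Matrix.toEuclideanCLM (n := Fin N → Fin (n + 1)) (𝕜 := ℂ) (scaledSpinOp n j)‖ ≤ 2 := by
  refine ContinuousLinearMap.opNorm_le_bound _ zero_le_two fun v => ?_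
  obtain ⟨μ, i⟩ := j
  have hs : 1 / 2 ≤ spin n := by
    have : (1 : ℝ) ≤ n := by exact_mod_cast Nat.one_le_iff_ne_zero.2 hn
    rw [spin]
    linarith
  have h1 := norm_sq_apply_le (fun i => isSelfAdjoint_siteSpinCLM n (μ, i))
    (sum_siteSpinCLM_mul_self n μ) v i
  -- `s (s + 1) ≤ (2 s)²` holds for `s ≥ 1/3`, hence for every nonzero spin.
  have h2 : ‖siteSpinCLM n (μ, i) v‖ ≤ 2 * spin n * ‖v‖ := by
    refine le_of_sq_le_sq (h1.trans ?_) (by positivity)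
    rw [mul_pow]
    gcongr
    nlinarith
  rw [toEuclideanCLM_scaledSpinOp, smul_apply, norm_smul, norm_inv,
    Complex.norm_real, Real.norm_eq_abs, abs_of_pos (by linarith), inv_mul_le_iff₀ (by linarith)]
  linarith

theorem norm_scaledSpinOp_coherentVector_sub_le {N n : ℕ} (hn : n ≠ 0) (j : Fin N × Fin 3)
    (Ω : PhaseSpace N) :
    ‖Matrix.toEuclideanCLM (𝕜 := ℂ) (scaledSpinOp n j) (coherentVector n Ω) -
      ((Ω j.1).1 j.2 : ℂ) • coherentVector n Ω‖ ≤ √(2 / n) := by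
  obtain ⟨μ, i⟩ := j
  have hs : 0 < spin n := by
    have : (1 : ℝ) ≤ n := by exact_mod_cast Nat.one_le_iff_ne_zero.2 hn
    rw [spin]
    linarith
  have hx : ∑ i, (Ω μ).1 i ^ 2 = 1 := by
    rw [Fin.sum_univ_three, sphere_coord_sq_sum]
  have h1 := norm_sq_apply_sub_le (fun i => isSelfAdjoint_siteSpinCLM n (μ, i))
    (sum_siteSpinCLM_mul_self n μ) hx (norm_coherentVector n Ω)
    (sum_siteSpinCLM_coherentVector n μ Ω) i
  have h2 : Matrix.toEuclideanCLM (𝕜 := ℂ) (scaledSpinOp n (μ, i)) (coherentVector n Ω) -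
      ((Ω μ).1 i : ℂ) • coherentVector n Ω = ((spin n : ℂ))⁻¹ •
        (siteSpinCLM n (μ, i) (coherentVector n Ω) -
          ((spin n * (Ω μ).1 i : ℝ) : ℂ) • coherentVector n Ω) := by
    rw [toEuclideanCLM_scaledSpinOp, smul_apply, smul_sub, smul_smul,
      Complex.ofReal_mul, inv_mul_cancel_left₀ (by exact_mod_cast hs.ne')]
  rw [h2, norm_smul, norm_inv, Complex.norm_real, Real.norm_eq_abs, abs_of_pos hs]
  refine Real.le_sqrt_of_sq_le ?_
  rw [mul_pow]
  calc _ ≤ (spin n)⁻¹ ^ 2 * spin n := by gcongr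
    _ = 2 / n := by
      rw [sq, mul_assoc, inv_mul_cancel₀ hs.ne', mul_one, spin, inv_div]

/-! ### The Hamiltonian and the Boltzmann operator on coherent states -/

section Hamiltonian

variable {N : ℕ} (p : ℕ) (J : Couplings N)

/-- An upper bound for the norms of the Hamiltonians. -/
def hamiltonianBound : ℝ :=
  ∑ q ∈ Finset.range (p + 1), ∑ j : Fin q → Fin N × Fin 3, |J q j| * 2 ^ q

/-- A Lipschitz bound for the Hamiltonians in terms of the scaled spin operators. -/
def hamiltonianLipschitz : ℝ :=
  ∑ q ∈ Finset.range (p + 1), ∑ j : Fin q → Fin N × Fin 3, |J q j| * (q * 2 ^ q)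

theorem toEuclideanCLM_hamiltonian (n : ℕ) :
    Matrix.toEuclideanCLM (𝕜 := ℂ) (hamiltonian p J n) =
      ∑ q ∈ Finset.range (p + 1), ∑ j : Fin q → Fin N × Fin 3, (J q j : ℂ) •
        (List.ofFn fun a => Matrix.toEuclideanCLM (n := Fin N → Fin (n + 1)) (𝕜 := ℂ)
          (scaledSpinOp n (j a))).prod := by
  simp only [hamiltonian, map_sum, map_smul, map_list_prod, List.map_ofFn, Function.comp_def]

theorem norm_toEuclideanCLM_hamiltonian_le {n : ℕ} (hn : n ≠ 0) :
    ‖Matrix.toEuclideanCLM (n := Fin N → Fin (n + 1)) (𝕜 := ℂ) (hamiltonian p J n)‖ ≤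
      hamiltonianBound p J := by
  rw [toEuclideanCLM_hamiltonian]
  refine norm_sum_le_of_le _ fun q _ => norm_sum_le_of_le _ fun j _ => ?_
  rw [norm_smul, Complex.norm_real, Real.norm_eq_abs]
  gcongr
  exact norm_listProd_ofFn_le _ fun a => norm_toEuclideanCLM_scaledSpinOp_le hn _

theorem abs_sphere_coord_le (ω : Sphere2) (i : Fin 3) : |ω.1 i| ≤ 1 := by
  have h := PiLp.norm_apply_le ω.1 i
  simpa using h

theorem abs_classicalHamiltonian_le (Ω : PhaseSpace N) :
    |classicalHamiltonian p J Ω| ≤ hamiltonianBound p J := by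
  rw [← Real.norm_eq_abs, classicalHamiltonian]
  refine norm_sum_le_of_le _ fun q _ => norm_sum_le_of_le _ fun j _ => ?_
  rw [Real.norm_eq_abs, abs_mul, Finset.abs_prod]
  gcongr
  calc ∏ a, |(Ω (j a).1).1 (j a).2| ≤ ∏ _a : Fin q, (2 : ℝ) :=
        Finset.prod_le_prod (fun _ _ => abs_nonneg _) fun a _ =>
          (abs_sphere_coord_le _ _).trans one_le_two
    _ = 2 ^ q := by simp

theorem norm_hamiltonian_coherentVector_sub_le {n : ℕ} (hn : n ≠ 0) (Ω : PhaseSpace N) :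
    ‖Matrix.toEuclideanCLM (𝕜 := ℂ) (hamiltonian p J n) (coherentVector n Ω) -
      (classicalHamiltonian p J Ω : ℂ) • coherentVector n Ω‖ ≤
        hamiltonianLipschitz p J * √(2 / n) := by
  rw [toEuclideanCLM_hamiltonian, classicalHamiltonian, hamiltonianLipschitz]
  simp only [sum_apply, smul_apply, Complex.ofReal_sum,
    Complex.ofReal_mul, Complex.ofReal_prod, Finset.sum_smul, ← Finset.sum_sub_distrib,
    Finset.sum_mul, mul_smul, ← smul_sub]
  refine norm_sum_le_of_le _ fun q _ => norm_sum_le_of_le _ fun j _ => ?_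
  rw [norm_smul, Complex.norm_real, Real.norm_eq_abs, mul_assoc]
  gcongr
  refine norm_listProd_ofFn_apply_sub_le _ (fun a => ((Ω (j a).1).1 (j a).2 : ℂ)) one_le_two
    (fun a => norm_toEuclideanCLM_scaledSpinOp_le hn _) (fun a => ?_)
    fun a => norm_scaledSpinOp_coherentVector_sub_le hn _ Ω
  rw [Complex.norm_real, Real.norm_eq_abs]
  exact (abs_sphere_coord_le _ _).trans one_le_two

/-- Cauchy–Schwarz against the unit vector `|Ω⟩`. The bound does not involve `Ω`, which makes the
convergence uniform. -/
theorem norm_covariantSymbol_boltzmann_sub_le (β : ℝ) {n : ℕ} (hn : n ≠ 0) (Ω : PhaseSpace N) :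
    ‖covariantSymbol (boltzmann p J β n) Ω - (Real.exp (-β * classicalHamiltonian p J Ω) : ℂ)‖ ≤
      Real.exp (3 * (|β| * hamiltonianBound p J)) * (|β| * hamiltonianLipschitz p J) *
        √(2 / n) := by
  set T := Matrix.toEuclideanCLM (n := Fin N → Fin (n + 1)) (𝕜 := ℂ) with hT
  set v := coherentVector n Ω with hv
  have hv1 : ‖v‖ = 1 := norm_coherentVector n Ω
  have hβ : ‖((-β : ℝ) : ℂ)‖ = |β| := by rw [Complex.norm_real, Real.norm_eq_abs, abs_neg]
  have h1 : covariantSymbol (boltzmann p J β n) Ω -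
      (Real.exp (-β * classicalHamiltonian p J Ω) : ℂ) =
      inner ℂ v (NormedSpace.exp (T (((-β : ℝ) : ℂ) • hamiltonian p J n)) v -
        Complex.exp (((-β : ℝ) : ℂ) * classicalHamiltonian p J Ω) • v) := by
    rw [inner_sub_right, inner_smul_right, inner_self_eq_norm_sq_to_K, hv1,
      covariantSymbol_eq_inner, boltzmann, toEuclideanCLM_exp]
    simp [hT, hv]
  have h2 := norm_exp_apply_sub_exp_smul_le (T (((-β : ℝ) : ℂ) • hamiltonian p J n))
    (((-β : ℝ) : ℂ) * classicalHamiltonian p J Ω) (M := |β| * hamiltonianBound p J) (by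
      rw [map_smul, norm_smul, hβ]
      gcongr
      exact norm_toEuclideanCLM_hamiltonian_le p J hn) (by
      rw [norm_mul, hβ, Complex.norm_real, Real.norm_eq_abs]
      gcongr
      exact abs_classicalHamiltonian_le p J Ω) v
  rw [h1]
  refine (norm_inner_le_norm _ _).trans ?_
  rw [hv1, one_mul, mul_assoc]
  refine h2.trans ?_
  gcongr
  rw [map_smul, smul_apply, mul_smul, ← smul_sub, norm_smul, hβ, mul_assoc]
  gcongr
  exact norm_hamiltonian_coherentVector_sub_le p J hn Ω

/-- The covariant symbol of the Boltzmann operator, as a continuous function. -/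
def boltzmannSymbol (β : ℝ) (n : ℕ) : C(PhaseSpace N, ℂ) :=
  ⟨covariantSymbol (boltzmann p J β n), continuous_covariantSymbol _⟩

/-- The classical Boltzmann factor. -/
def classicalBoltzmann (β : ℝ) : C(PhaseSpace N, ℂ) where
  toFun Ω := (Real.exp (-β * classicalHamiltonian p J Ω) : ℂ)
  continuous_toFun := by
    have h := continuous_classicalHamiltonian p J
    fun_prop

theorem tendsto_boltzmannSymbol (β : ℝ) :
    Tendsto (boltzmannSymbol p J β) atTop (𝓝 (classicalBoltzmann p J β)) := by
  rw [tendsto_iff_norm_sub_tendsto_zero]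
  have hz : Tendsto (fun n : ℕ => Real.exp (3 * (|β| * hamiltonianBound p J)) *
      (|β| * hamiltonianLipschitz p J) * √(2 / n)) atTop (𝓝 0) := by
    have := ((Real.continuous_sqrt.tendsto 0).comp
      (tendsto_const_div_atTop_nhds_zero_nat 2)).const_mul
        (Real.exp (3 * (|β| * hamiltonianBound p J)) * (|β| * hamiltonianLipschitz p J))
    simpa using this
  refine squeeze_zero' (.of_forall fun _ => norm_nonneg _) ?_ hz
  filter_upwards [eventually_ne_atTop 0] with n hn
  rw [ContinuousMap.norm_le _ (by
    unfold hamiltonianLipschitz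
    positivity)]
  exact norm_covariantSymbol_boltzmann_sub_le p J β hn

theorem scaled_trace_boltzmann_eq (β : ℝ) (n : ℕ) :
    (((n : ℂ) + 1) ^ N)⁻¹ * Matrix.trace (boltzmann p J β n) =
      (((4 * Real.pi) ^ N : ℝ) : ℂ)⁻¹ *
        ∫ Ω, boltzmannSymbol p J β n Ω ∂(Measure.pi fun _ : Fin N => sphereMeasure) := by
  have h := integral_covariantSymbol (boltzmann p J β n)
  have h1 : ∫ Ω, boltzmannSymbol p J β n Ω ∂(Measure.pi fun _ : Fin N => sphereMeasure) = _ := h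
  have hπ : (Real.pi : ℂ) ≠ 0 := by exact_mod_cast Real.pi_ne_zero
  have hn : (n : ℂ) + 1 ≠ 0 := Nat.cast_add_one_ne_zero n
  rw [h1]
  push_cast
  rw [div_pow]
  field_simp

theorem tendsto_scaled_trace_boltzmann (β : ℝ) :
    Tendsto (fun n : ℕ => (((n : ℂ) + 1) ^ N)⁻¹ * Matrix.trace (boltzmann p J β n))
      atTop (𝓝 (classicalPartition p J β : ℂ)) := by
  -- The measure is finite, so integration is continuous in the sup-norm and commutes with the
  -- uniform limit.
  have hcont : Continuous fun f : C(PhaseSpace N, ℂ) =>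
      ∫ Ω, f Ω ∂(Measure.pi fun _ : Fin N => sphereMeasure) := by
    refine (continuous_integral.comp (ContinuousMap.toLp (E := ℂ) 1
      (Measure.pi fun _ : Fin N => sphereMeasure) ℂ).continuous).congr fun f => ?_
    exact integral_congr_ae (ContinuousMap.coeFn_toLp _ f)
  have hZ : (classicalPartition p J β : ℂ) = (((4 * Real.pi) ^ N : ℝ) : ℂ)⁻¹ *
      ∫ Ω, classicalBoltzmann p J β Ω ∂(Measure.pi fun _ : Fin N => sphereMeasure) := by
    rw [classicalPartition, Complex.ofReal_mul, Complex.ofReal_inv, ← integral_complex_ofReal]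
    rfl
  simp only [scaled_trace_boltzmann_eq]
  rw [hZ]
  exact ((hcont.tendsto _).comp (tendsto_boltzmannSymbol p J β)).const_mul _

theorem classicalPartition_pos (β : ℝ) : 0 < classicalPartition p J β := by
  have h := continuous_classicalHamiltonian p J
  -- The total mass is the product of the masses of the spheres, none of which vanishes; positivity
  -- of the integrand then suffices.
  have : NeZero (Measure.pi fun _ : Fin N => sphereMeasure) := by
    refine ⟨fun h0 => ?_⟩
    have h1 := congrArg (fun ν => ν Set.univ) h0
    simp only [Measure.pi_univ, Measure.coe_zero, Pi.zero_apply, Finset.prod_eq_zero_iff,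
      Measure.measure_univ_eq_zero] at h1
    obtain ⟨_, _, h1⟩ := h1
    exact Measure.toSphere_ne_zero _ h1
  unfold classicalPartition
  refine mul_pos (by positivity) (integral_exp_pos ?_)
  exact Continuous.integrable_of_hasCompactSupport (by fun_prop)
    (HasCompactSupport.of_compactSpace _)

theorem classicalGibbs_eq (β : ℝ) :
    classicalGibbs p J β = (classicalPartition p J β : ℂ)⁻¹ • classicalBoltzmann p J β := by
  ext Ω
  simp [classicalGibbs, classicalBoltzmann]

theorem covariantSymbol_smul {n : ℕ} (c : ℂ) (A : Operator N n) (Ω : PhaseSpace N) :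
    covariantSymbol (c • A) Ω = c * covariantSymbol A Ω := by
  simp only [covariantSymbol, Matrix.smul_mulVec, dotProduct_smul, smul_eq_mul]

theorem tendsto_gibbsSymbol (β : ℝ) :
    Tendsto (fun n : ℕ => ((n : ℂ) + 1) ^ N •
      ((Matrix.trace (boltzmann p J β n))⁻¹ • boltzmannSymbol p J β n)) atTop
      (𝓝 (classicalGibbs p J β)) := by
  rw [classicalGibbs_eq]
  have hZ : (classicalPartition p J β : ℂ) ≠ 0 := by
    exact_mod_cast (classicalPartition_pos p J β).ne'
  refine (((tendsto_scaled_trace_boltzmann p J β).inv₀ hZ).smul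
    (tendsto_boltzmannSymbol p J β)).congr fun n => ?_
  -- Valid also where the trace vanishes: with `0⁻¹ = 0` both sides are zero, matching the
  -- convention `G = 0`.
  rw [mul_inv, inv_inv, mul_smul]

end Hamiltonian

end SpinGibbs

end

theorem theorem3p3 (N p : ℕ) (J : SpinGibbs.Couplings N) (β : ℝ) (hβ : 0 < β) :
    (∃ g : ℕ → C(SpinGibbs.PhaseSpace N, ℂ),
      (∀ n Ω, g n Ω = SpinGibbs.covariantSymbol (SpinGibbs.gibbsState p J β n) Ω) ∧
      Tendsto (fun n : ℕ => ‖((n : ℂ) + 1) ^ N • g n - SpinGibbs.classicalGibbs p J β‖)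
        atTop (𝓝 0)) ∧
    Tendsto (fun n : ℕ => (((n : ℂ) + 1) ^ N)⁻¹ * Matrix.trace (SpinGibbs.boltzmann p J β n))
      atTop (𝓝 (SpinGibbs.classicalPartition p J β : ℂ)) := by
  refine ⟨⟨fun n => (Matrix.trace (SpinGibbs.boltzmann p J β n))⁻¹ •
    SpinGibbs.boltzmannSymbol p J β n, fun n Ω => ?_, ?_⟩,
    SpinGibbs.tendsto_scaled_trace_boltzmann p J β⟩
  · exact (SpinGibbs.covariantSymbol_smul _ _ Ω).symm
  · exact tendsto_iff_norm_sub_tendsto_zero.1 (SpinGibbs.tendsto_gibbsSymbol p J β)
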